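/- For a finite group $\Gamma$ and an irreducible complex character $\chi$ of $\Gamma$ put $\mathrm{cod}(\chi)=|\Gamma:\ker\chi|/\chi(1)$. Let $\sigma^c(\Gamma)$ be the maximal integer $m$ such that some $\mathrm{cod}(\chi)$, $\chi\in\mathrm{Irr}(\Gamma)$, has exactly $m$ distinct prime divisors, and let $\pi(\Gamma)$ be the set of prime divisors of $|\Gamma|$. "Fixed point freely" means that no non-trivial element of the acting group fixes a non-trivial element. **Example groups.** Let $q_1,\dots,q_4,r_1,\dots,r_4$ be mutually distinct primes with $q_1\mid r_1-1$, $q_2\mid r_2-1$, $q_1q_2q_3\mid r_3-1$, $q_2q_4\mid r_4-1$. Let $Q_i$ and $R_i$ be cyclic of order $q_i$ and $r_i$, and let $L=(R_1\times R_2\times R_3\times R_4)\rtimes(Q_1\times Q_2\times Q_3\times Q_4)$, where each $Q_i$ acts on each $R_j$ either trivially or fixed point freely, namely $Q_1$ fixed point freely exactly on $R_1,R_3$; $Q_2$ exactly on $R_2,R_3,R_4$; $Q_3$ exactly on $R_3$; $Q_4$ exactly on $R_4$. Let $s_1,\dots,s_4$ be mutually distinct primes with $q_1q_2q_3q_4r_1r_2r_3r_4\mid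 s_k-1$ for every $k$. Put $T_1=\{1\}$, $T_2=\{2\}$, $T_3=\{1,2,3\}$, $T_4=\{1,2,4\}$. For $k=1,\dots,4$ let $V_k$ be a finite-dimensional $GF(s_k)L$-module such that * restricted to the subgroup $\prod_{i\in T_k}Q_i\prod_{i\in T_k}R_i$ of $L$, the module $V_k$ is faithful and irreducible, and $\prod_{i\in T_k}R_i$ acts fixed point freely on $V_k$; * for $i\notin T_k$, $Q_i$ acts on $V_k$ fixed point freely by multiplication with elements of $GF(s_k)$, and $R_i$ acts trivially on $V_k$. Let $G=(V_1\times V_2\times V_3\times V_4)\rtimes L$, and regard all $Q_i,R_j,V_k$ as subgroups of $G$. **Proposition.** For every such group $G$, the subgroups $H=Q_1Q_2R_1R_3V_1$ and $K=Q_2Q_3Q_4R_2R_4V_1V_3V_4$ satisfy $\sigma^c(H)=2$, $|\pi(H)|=5$, $\sigma^c(K)=3$ and $|\pi(K)|=8$. Such groups $G$ exist for every choice of distinct primes $q_1,q_2,q_3,q_4$. Consequently there is a finite group $\Gamma$ with $\sigma^c(\Gamma)=2$ and $|\pi(\Gamma)|=5$, and a finite group $\Gamma$ with $\sigma^c(\Gamma)=3$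 and $|\pi(\Gamma)|=8$; that is, the values $5$ and $8$ are attained, so that no upper bound for $|\pi(\Gamma)|$ under $\sigma^c(\Gamma)=2$ (respectively $3$) can be smaller than $5$ (respectively $8$). -/

import Mathlib

noncomputable section

/-! ### Character codegrees -/

/-- The codegree `|G : ker χ| / χ(1)` of the character `χ` of a complex representation `ρ`
(recall `ker χ = ker ρ` and `χ(1) = dim ρ`; for irreducible `ρ` of a finite group
the division is exact, as `χ(1)` divides `|G : ker χ|`). -/
def codegree {G : Type*} [Group G] {n : ℕ} (ρ : Representation ℂ G (Fin n → ℂ)) : ℕ :=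
  (MonoidHom.ker ρ).index / Module.finrank ℂ (Fin n → ℂ)

/-- The set `cod(G)` of the codegrees of all irreducible complex characters of `G`. -/
def codegreeSet (G : Type*) [Group G] : Set ℕ :=
  {c | ∃ (n : ℕ) (ρ : Representation ℂ G (Fin n → ℂ)), ρ.IsIrreducible ∧ c = codegree ρ}

/-- `σᶜ(G)`: the maximal number of distinct prime divisors of a member of `cod(G)`. For a finite
group the set is non-empty and bounded, so that the supremum is a maximum. -/
def sigmaCod (G : Type*) [Group G] : ℕ :=
  sSup {m | ∃ c ∈ codegreeSet G, m = c.primeFactors.card}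

/-- `π(G)`: the set of prime divisors of `|G|`. -/
def primeSet (G : Type*) [Group G] : Finset ℕ :=
  (Nat.card G).primeFactors

/-! ### The example group

Indices run over `Fin 4 = {0, 1, 2, 3}` and stand for `1, 2, 3, 4`. -/

/-- `fpfIndices i` is the set of the `j` such that `Q_i` acts fixed point freely on `R_j`;
on the other `R_j` it acts trivially. -/
def fpfIndices : Fin 4 → Finset (Fin 4) :=
  ![{0, 2}, {1, 2, 3}, {2}, {3}]

/-- `blockIndices k` is the set of the `i` such that `Q_i` and `R_i` belong to the group of which
`V_k` is constructed as a faithful irreducible module. -/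
def blockIndices : Fin 4 → Finset (Fin 4) :=
  ![{0}, {1}, {0, 1, 2}, {0, 1, 3}]

/-- The top part of the example: the primes `q_i`, `r_i`, the cyclic groups `Q_i = ℤ/q_i` and
`R_j = ℤ/r_j`, and the action of `Q_0 × Q_1 × Q_2 × Q_3` on `R_0 × R_1 × R_2 × R_3`. As the `r_j`
are distinct primes, the action leaves every `R_j` invariant. -/
structure TopData where
  q : Fin 4 → ℕ
  r : Fin 4 → ℕ
  q_prime : ∀ i, (q i).Prime
  r_prime : ∀ i, (r i).Prime
  distinct : Function.Injective (Sum.elim q r)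
  dvd_zero : q 0 ∣ r 0 - 1
  dvd_one : q 1 ∣ r 1 - 1
  dvd_two : q 0 * q 1 * q 2 ∣ r 2 - 1
  dvd_three : q 1 * q 3 ∣ r 3 - 1
  φ : (∀ i, Multiplicative (ZMod (q i))) →* MulAut (∀ j, Multiplicative (ZMod (r j)))
  acts_fpf : ∀ i, ∀ j ∈ fpfIndices i, ∀ x : Multiplicative (ZMod (q i)), x ≠ 1 →
    ∀ y : Multiplicative (ZMod (r j)), y ≠ 1 →
      φ (Pi.mulSingle i x) (Pi.mulSingle j y) ≠ Pi.mulSingle j y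
  acts_trivially : ∀ i, ∀ j ∉ fpfIndices i, ∀ (x : Multiplicative (ZMod (q i)))
    (y : Multiplicative (ZMod (r j))),
      φ (Pi.mulSingle i x) (Pi.mulSingle j y) = Pi.mulSingle j y

namespace TopData

variable (D : TopData)

/-- The group `G/G'' = (R_0 × R_1 × R_2 × R_3) ⋊ (Q_0 × Q_1 × Q_2 × Q_3)`. -/
abbrev L : Type :=
  (∀ j, Multiplicative (ZMod (D.r j))) ⋊[D.φ] (∀ i, Multiplicative (ZMod (D.q i)))

/-- The embedding of `Q_i` into `L`. -/
def ιQ (i : Fin 4) : Multiplicative (ZMod (D.q i)) →* D.L :=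
  SemidirectProduct.inr.comp (MonoidHom.mulSingle (fun i => Multiplicative (ZMod (D.q i))) i)

/-- The embedding of `R_j` into `L`. -/
def ιR (j : Fin 4) : Multiplicative (ZMod (D.r j)) →* D.L :=
  SemidirectProduct.inl.comp (MonoidHom.mulSingle (fun j => Multiplicative (ZMod (D.r j))) j)

/-- The subgroup of `L` that is the product of the `R_i`, `i ∈ T`. -/
def subR (T : Finset (Fin 4)) : Subgroup D.L :=
  ⨆ i ∈ T, (D.ιR i).range

/-- The subgroup of `L` that is the product of the `Q_i` and the `R_i`, `i ∈ T`. -/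
def subQR (T : Finset (Fin 4)) : Subgroup D.L :=
  ⨆ i ∈ T, ((D.ιQ i).range ⊔ (D.ιR i).range)

end TopData

/-- All choices in the construction of the example group: the top part, the primes `s_k` and the
modules `V_k` over `GF(s_k)`, the vector space `GF(s_k)^(d_k)` with an action `ρ_k` of `L`. -/
structure ExampleData extends TopData where
  s : Fin 4 → ℕ
  s_prime : ∀ k, Fact (s k).Prime
  s_injective : Function.Injective s
  dvd_s : ∀ k, (∏ i, q i) * (∏ i, r i) ∣ s k - 1
  d : Fin 4 → ℕ
  ρ : ∀ k, Representation (ZMod (s k)) toTopData.L (Fin (d k) → ZMod (s k))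
  /-- `V_k` is a faithful module for the product of the `Q_i`, `R_i`, `i ∈ blockIndices k`. -/
  faithful : ∀ k, ∀ g ∈ toTopData.subQR (blockIndices k), ρ k g = 1 → g = 1
  /-- `V_k` is an irreducible module for the product of the `Q_i`, `R_i`, `i ∈ blockIndices k`. -/
  irreducible : ∀ k,
    Representation.IsIrreducible ((ρ k).comp (toTopData.subQR (blockIndices k)).subtype)
  /-- The product of the `R_i`, `i ∈ blockIndices k`, acts fixed point freely on `V_k`. -/
  R_fpf : ∀ k, ∀ g ∈ toTopData.subR (blockIndices k), g ≠ 1 → ∀ v, ρ k g v = v → v = 0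
  /-- The other `Q_i` act on `V_k` by multiplication with elements of `GF(s_k)` ... -/
  Q_scalar : ∀ k, ∀ i ∉ blockIndices k, ∀ x, ∃ c : ZMod (s k), ∀ v, ρ k (toTopData.ιQ i x) v = c • v
  /-- ... and fixed point freely. -/
  Q_fpf : ∀ k, ∀ i ∉ blockIndices k, ∀ x, x ≠ 1 → ∀ v, ρ k (toTopData.ιQ i x) v = v → v = 0
  /-- The other `R_i` act trivially on `V_k`. -/
  R_trivial : ∀ k, ∀ i ∉ blockIndices k, ∀ y, ρ k (toTopData.ιR i y) = 1

namespace ExampleData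

variable (E : ExampleData)

/-- The action of `L` on the (multiplicatively written) group `V_0 × V_1 × V_2 × V_3`. -/
def ψ : E.L →* MulAut (∀ k, Multiplicative (Fin (E.d k) → ZMod (E.s k))) where
  toFun g :=
    { toFun := fun v k => Multiplicative.ofAdd (E.ρ k g (Multiplicative.toAdd (v k)))
      invFun := fun v k => Multiplicative.ofAdd (E.ρ k g⁻¹ (Multiplicative.toAdd (v k)))
      left_inv := fun v => by funext k; simp
      right_inv := fun v => by funext k; simp
      map_mul' := fun v w => by funext k; simp }
  map_one' := by ext v k; simp
  map_mul' g h := by ext v k; simp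

/-- The example group `G = (V_0 × V_1 × V_2 × V_3) ⋊ L`. -/
abbrev G : Type :=
  (∀ k, Multiplicative (Fin (E.d k) → ZMod (E.s k))) ⋊[E.ψ] E.L

/-- The subgroup `Q_i` of `G`. -/
def Q (i : Fin 4) : Subgroup E.G :=
  ((SemidirectProduct.inr : E.L →* E.G).comp (E.ιQ i)).range

/-- The subgroup `R_j` of `G`. -/
def R (j : Fin 4) : Subgroup E.G :=
  ((SemidirectProduct.inr : E.L →* E.G).comp (E.ιR j)).range

/-- The subgroup `V_k` of `G`. -/
def V (k : Fin 4) : Subgroup E.G :=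
  ((SemidirectProduct.inl : _ →* E.G).comp
    (MonoidHom.mulSingle (fun k => Multiplicative (Fin (E.d k) → ZMod (E.s k))) k)).range

/-- In indices `1, ..., 4`: the subgroup `H = Q_1 Q_2 R_1 R_3 V_1`. The factors normalize one
another suitably, so that the product is the subgroup generated by them; the same holds for `K`. -/
def H : Subgroup E.G :=
  E.Q 0 ⊔ E.Q 1 ⊔ E.R 0 ⊔ E.R 2 ⊔ E.V 0

/-- In indices `1, ..., 4`: the subgroup `K = Q_2 Q_3 Q_4 R_2 R_4 V_1 V_3 V_4`. -/
def K : Subgroup E.G :=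
  E.Q 1 ⊔ E.Q 2 ⊔ E.Q 3 ⊔ E.R 1 ⊔ E.R 3 ⊔ E.V 0 ⊔ E.V 2 ⊔ E.V 3

end ExampleData

end

/-! Upper bounds: let `χ` be an irreducible character of `H` or `K`. Each of the factors `Q_i`,
`R_j`, `V_k` is a Sylow subgroup for its own prime, and there are two ways to see that such a prime
`p` does not divide `cod(χ)`. If the factor lies in `ker χ`, then `p` does not divide `|Γ : ker χ|`.
If the factor `P` has order `p` and acts fixed point freely on a subgroup `M` that is normal modulo
`ker χ` but not contained in it, then `χ` vanishes on `P \ {1}`, so `p` divides `χ(1)`; as `p²` does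
not divide `|Γ|`, `p` does not divide `cod(χ)`. Distinguishing which `V_k` and `R_j` lie in `ker χ`,
each case excludes three of the five primes of `H` and five of the eight primes of `K`
(`card_primeFactors_codegree_le_two`, `card_primeFactors_codegree_le_three`).

Lower bounds: a linear character that is faithful on every `Q_i` has codegree divisible by every
`q_i` that occurs, two for `H` and three for `K` (`sigmaCod_block`).

Existence: primes congruent to 1 modulo the required products supply `r_j` and `s_k`. The `Q_i` act
on the `R_j` by multiplication with roots of unity, and `V_k` is a monomial module on the functions
on `∏ Q_i`, `i ∈ T_k` (`TopData.exists_module`). -/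

open Module

/-! ### Irreducibility in terms of invariant subspaces -/

namespace Representation

section Irreducible

variable {k G V : Type*} [Field k] [Monoid G] [AddCommGroup V] [Module k V]

theorem isIrreducible_iff_forall_submodule (ρ : Representation k G V) :
    ρ.IsIrreducible ↔ Nontrivial V ∧
      ∀ U : Submodule k V, (∀ g, ∀ v ∈ U, ρ g v ∈ U) → U = ⊥ ∨ U = ⊤ := by
  constructor
  · intro h
    refine ⟨?_, fun U hU => ?_⟩
    · by_contra hV
      rw [not_nontrivial_iff_subsingleton] at hV
      exact bot_ne_top (α := Subrepresentation ρ)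
        (Subrepresentation.toSubmodule_injective (Subsingleton.elim _ _))
    · rcases h.eq_bot_or_eq_top (⟨U, fun g v hv => hU g v hv⟩ : Subrepresentation ρ) with h | h
      · exact Or.inl (congrArg Subrepresentation.toSubmodule h)
      · exact Or.inr (congrArg Subrepresentation.toSubmodule h)
  · rintro ⟨hV, h⟩
    refine { exists_pair_ne := ⟨⊥, ⊤, fun e => ?_⟩, eq_bot_or_eq_top := fun U => ?_ }
    · exact bot_ne_top (α := Submodule k V) (congrArg Subrepresentation.toSubmodule e)
    · rcases h U.toSubmodule (fun g v hv => U.apply_mem_toSubmodule g hv) with h | h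
      · exact Or.inl (Subrepresentation.toSubmodule_injective h)
      · exact Or.inr (Subrepresentation.toSubmodule_injective h)

end Irreducible

/-! ### Degrees of irreducible characters -/

section Degree

variable {G V : Type*} [Group G] [Finite G] [AddCommGroup V] [Module ℂ V] [FiniteDimensional ℂ V]

/-- The eigenvalues are roots of unity because `ρ g` has finite order, and the trace is their sum.
-/
theorem isIntegral_character (ρ : Representation ℂ G V) (g : G) :
    IsIntegral ℤ (ρ.character g) := by
  rw [character, Module.End.trace_eq_sum_roots_charpoly_of_splits (IsAlgClosed.splits _)]
  refine IsIntegral.multiset_sum fun μ hμ => ?_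
  have hev : Module.End.HasEigenvalue (ρ g) μ := by
    rw [Module.End.hasEigenvalue_iff_isRoot_charpoly]
    exact Polynomial.isRoot_of_mem_roots hμ
  obtain ⟨v, hv⟩ := hev.exists_hasEigenvector
  have h1 : μ ^ Nat.card G = 1 := by
    have h2 := hv.pow_apply (Nat.card G)
    rw [← map_pow, pow_card_eq_one', map_one, Module.End.one_apply] at h2
    have h3 : (μ ^ Nat.card G - 1) • v = 0 := by rw [sub_smul, ← h2, one_smul, sub_self]
    exact sub_eq_zero.1 ((smul_eq_zero.1 h3).resolve_right hv.2)
  exact IsIntegral.of_pow Nat.card_pos (h1 ▸ isIntegral_one)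

-- Schur's lemma over the algebraically closed field `ℂ`.
omit [Finite G] in
theorem IsIrreducible.exists_eq_smul_of_commute (ρ : Representation ℂ G V) (hρ : ρ.IsIrreducible)
    (T : V →ₗ[ℂ] V) (hT : ∀ g, T * ρ g = ρ g * T) : ∃ c : ℂ, T = c • 1 := by
  obtain ⟨c, hc⟩ := (IsIrreducible.algebraMap_intertwiningMap_bijective_of_isAlgClosed
    (ρ := ρ)).2 ⟨T, fun g => hT g⟩
  exact ⟨c, (congrArg IntertwiningMap.toLinearMap hc).symm⟩

/-- The degree of an irreducible representation divides the group order. -/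
theorem IsIrreducible.finrank_dvd_card (ρ : Representation ℂ G V) (hρ : ρ.IsIrreducible) :
    finrank ℂ V ∣ Nat.card G := by
  classical
  have := Fintype.ofFinite G
  have hG : (Nat.card G : ℂ) ≠ 0 := Nat.cast_ne_zero.2 Nat.card_pos.ne'
  have := invertibleOfNonzero hG
  have hV : Nontrivial V := ((isIrreducible_iff_forall_submodule ρ).1 hρ).1
  -- With coefficients in the ring of algebraic integers, the group ring is finite over `A`, so the
  -- element `z = ∑ χ(g⁻¹) g` is integral. It acts as a scalar `c` by Schur's lemma, and
  -- orthonormality gives `c = |G| / χ(1)`. This number is rational and integral, hence an integer.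
  let A := integralClosure ℤ ℂ
  let χ : G → A := fun g => ⟨ρ.character g, isIntegral_character ρ g⟩
  let z : MonoidAlgebra A G := ∑ g, MonoidAlgebra.single g (χ g⁻¹)
  let Φ : MonoidAlgebra A G →ₐ[A] End ℂ V := MonoidAlgebra.lift A (End ℂ V) G ρ
  have hz : Φ z = ∑ g, ρ.character g⁻¹ • ρ g := by
    simp only [z, Φ, map_sum, MonoidAlgebra.lift_single]
    rfl
  have hcomm : ∀ h, Φ z * ρ h = ρ h * Φ z := by
    intro h
    rw [hz, Finset.sum_mul, Finset.mul_sum]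
    refine Fintype.sum_equiv (MulAut.conj h⁻¹).toEquiv _ _ fun g => ?_
    simp only [smul_mul_assoc, mul_smul_comm, ← map_mul]
    congr 1
    · simp only [MulEquiv.toEquiv_eq_coe, EquivLike.coe_coe, MulAut.conj_apply]
      rw [conj_inv, char_conj]
    · simp [mul_assoc]
  obtain ⟨c, hc⟩ := hρ.exists_eq_smul_of_commute ρ (Φ z) hcomm
  have htr : c * finrank ℂ V = Nat.card G := by
    have h1 := char_orthonormal ρ ρ
    rw [if_pos ⟨Representation.Equiv.refl ρ⟩] at h1
    have h2 : LinearMap.trace ℂ V (Φ z) = Nat.card G := by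
      rw [hz]
      simp only [map_sum, map_smul, smul_eq_mul]
      rw [inv_mul_eq_iff_eq_mul₀ hG, mul_one] at h1
      rw [← h1]
      exact Finset.sum_congr rfl fun g _ => mul_comm _ _
    rw [← h2, hc]
    simp
  have hint : IsIntegral ℤ c := by
    have h1 : IsIntegral A (Φ z) := (IsIntegral.of_finite A z).map Φ
    rw [hc] at h1
    have h2 : IsIntegral A ((IsScalarTower.toAlgHom A ℂ (End ℂ V)) c) := by
      convert h1 using 1
      simp [Algebra.algebraMap_eq_smul_one]
    rw [isIntegral_algHom_iff _ (FaithfulSMul.algebraMap_injective ℂ (End ℂ V))] at h2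
    exact isIntegral_trans c h2
  have hn : (finrank ℂ V : ℂ) ≠ 0 := Nat.cast_ne_zero.2 finrank_pos.ne'
  have hcq : c = algebraMap ℚ ℂ ((Nat.card G : ℚ) / finrank ℂ V) := by
    rw [map_div₀, map_natCast, map_natCast, eq_div_iff hn, htr]
  rw [hcq, isIntegral_algebraMap_iff (algebraMap ℚ ℂ).injective,
    IsIntegrallyClosed.isIntegral_iff] at hint
  obtain ⟨y, hy⟩ := hint
  have hn' : (finrank ℂ V : ℚ) ≠ 0 := Nat.cast_ne_zero.2 finrank_pos.ne'
  rw [eq_div_iff hn'] at hy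
  have h3 : y * (finrank ℂ V : ℤ) = (Nat.card G : ℤ) := by
    have h4 : ((y * (finrank ℂ V : ℤ) : ℤ) : ℚ) = ((Nat.card G : ℤ) : ℚ) := by
      push_cast
      simpa using hy
    exact_mod_cast h4
  exact Int.natCast_dvd_natCast.1 (Dvd.intro_left _ h3)

/-- The degree of an irreducible representation divides the index of its kernel. -/
theorem IsIrreducible.finrank_dvd_index_ker (ρ : Representation ℂ G V) (hρ : ρ.IsIrreducible) :
    finrank ℂ V ∣ (MonoidHom.ker ρ).index := by
  let σ : Representation ℂ (G ⧸ MonoidHom.ker ρ) V :=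
    QuotientGroup.lift (MonoidHom.ker ρ) (ρ : G →* End ℂ V) fun _ hx => hx
  have hmk : ∀ g : G, σ (QuotientGroup.mk g) = ρ g := fun _ => rfl
  have hσ : σ.IsIrreducible := by
    rw [isIrreducible_iff_forall_submodule] at hρ ⊢
    refine ⟨hρ.1, fun U hU => hρ.2 U fun g v hv => ?_⟩
    have h := hU (QuotientGroup.mk g) v hv
    rwa [hmk] at h
  exact hσ.finrank_dvd_card σ

end Degree

/-! ### Fixed point free action and divisibility of the degree -/

section FixedPointFree

variable {G V : Type*} [Group G] [Finite G] [AddCommGroup V] [Module ℂ V] [FiniteDimensional ℂ V]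

omit [FiniteDimensional ℂ V] in
/-- If `x` acts fixed point freely on `M` and `M` has no invariants, then `x` has trace zero. -/
theorem character_eq_zero_of_fpf (ρ : Representation ℂ G V) (M : Subgroup G)
    (hM : ∀ v, (∀ m ∈ M, ρ m v = v) → v = 0) (x : G) (hx : ∀ m ∈ M, x * m * x⁻¹ ∈ M)
    (hfpf : ∀ m ∈ M, x * m = m * x → m = 1) : ρ.character x = 0 := by
  classical
  have := Fintype.ofFinite G
  -- The image of this sum consists of `M`-invariant vectors.
  have hsum : ∑ m : M, ρ m = 0 := by
    ext v
    rw [LinearMap.zero_apply]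
    refine hM _ fun n hn => ?_
    rw [← Module.End.mul_apply, Finset.mul_sum]
    congr 1
    refine Fintype.sum_equiv (Equiv.mulLeft (⟨n, hn⟩ : M)) _ _ fun m => ?_
    simp
  -- Since `f m * x = m * x * m⁻¹` and `f` is injective by fixed point freeness, the conjugates of
  -- `x` under `M` run exactly once over the coset `M x`. The sum of `ρ` over this coset is zero,
  -- while its trace is `|M| χ(x)`.
  let f : M → M := fun m => m * ⟨x * m⁻¹ * x⁻¹, hx _ (inv_mem m.2)⟩
  have hf : Function.Injective f := by
    intro m n hmn
    have h1 : (m : G) * (x * (m : G)⁻¹ * x⁻¹) = n * (x * (n : G)⁻¹ * x⁻¹) :=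
      congrArg Subtype.val hmn
    have h2 := hfpf ((n : G)⁻¹ * m) (M.mul_mem (inv_mem n.2) m.2) (by
      have h3 : x * (n : G)⁻¹ * m = ((n : G)⁻¹ * (n * (x * (n : G)⁻¹ * x⁻¹))) * x * m := by group
      rw [← mul_assoc, h3, ← h1]
      group)
    exact Subtype.ext (inv_mul_eq_one.1 h2).symm
  have hb : Function.Bijective f := Finite.injective_iff_bijective.1 hf
  have h1 : ∑ m : M, ρ ((m : G) * x * (m : G)⁻¹) = 0 := by
    calc ∑ m : M, ρ ((m : G) * x * (m : G)⁻¹) = ∑ m : M, ρ (f m) * ρ x := by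
          refine Finset.sum_congr rfl fun m _ => ?_
          rw [← map_mul]
          congr 1
          simp only [f, Subgroup.coe_mul, Subgroup.coe_inv]
          group
      _ = (∑ m : M, ρ m) * ρ x := by
          rw [Finset.sum_mul]
          exact Fintype.sum_bijective f hb _ _ fun m => rfl
      _ = 0 := by rw [hsum, zero_mul]
  have h2 := congrArg (LinearMap.trace ℂ V) h1
  rw [map_sum, map_zero] at h2
  have h3 : ∀ m : M, LinearMap.trace ℂ V (ρ ((m : G) * x * (m : G)⁻¹)) = ρ.character x :=
    fun m => char_conj ρ x m
  rw [Finset.sum_congr rfl fun m _ => h3 m, Finset.sum_const, nsmul_eq_mul, mul_eq_zero] at h2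
  refine h2.resolve_left (Nat.cast_ne_zero.2 ?_)
  exact Finset.card_ne_zero.2 ⟨1, Finset.mem_univ _⟩

/-- The dimension of the space of `P`-invariants is the average of the character over `P`, here
`χ(1) / |P|`. -/
theorem card_dvd_finrank_of_character_eq_zero (ρ : Representation ℂ G V) (P : Subgroup G)
    (hP : ∀ x ∈ P, x ≠ 1 → ρ.character x = 0) : Nat.card P ∣ finrank ℂ V := by
  classical
  have := Fintype.ofFinite G
  have hc : (Nat.card P : ℂ) ≠ 0 := Nat.cast_ne_zero.2 Nat.card_pos.ne'
  have := invertibleOfNonzero hc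
  have h1 := card_inv_mul_sum_char_eq_finrank (ρ.comp P.subtype : Representation ℂ P V)
  rw [Finset.sum_eq_single 1, char_one, inv_mul_eq_iff_eq_mul₀ hc] at h1
  · exact Dvd.intro _ (by exact_mod_cast h1.symm)
  · intro x _ hx
    exact hP x x.2 fun h => hx (Subtype.ext h)
  · simp

/-- A subgroup that acts fixed point freely on `M`, where `M` is normal modulo `ker ρ` and not
contained in `ker ρ`, has order dividing the degree of the irreducible representation `ρ`. -/
theorem IsIrreducible.card_dvd_finrank_of_fpf (ρ : Representation ℂ G V) (hρ : ρ.IsIrreducible)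
    (P M : Subgroup G) (hnormal : ∀ g, ∀ m ∈ M, ∃ n ∈ M, ρ (g * m * g⁻¹) = ρ n)
    (hker : ∃ m ∈ M, ρ m ≠ 1) (hPM : ∀ x ∈ P, ∀ m ∈ M, x * m * x⁻¹ ∈ M)
    (hfpf : ∀ x ∈ P, x ≠ 1 → ∀ m ∈ M, x * m = m * x → m = 1) :
    Nat.card P ∣ finrank ℂ V := by
  refine card_dvd_finrank_of_character_eq_zero ρ P fun x hx hx1 =>
    character_eq_zero_of_fpf ρ M ?_ x (hPM x hx) (hfpf x hx hx1)
  -- Normality of `M` modulo the kernel makes the space `U` of `M`-invariants a subrepresentation;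
  -- it is not everything as `M` acts non-trivially, so it is zero.
  let U : Submodule ℂ V := ⨅ m : M, LinearMap.ker (ρ m - 1)
  have hU : ∀ v, v ∈ U ↔ ∀ m ∈ M, ρ m v = v := by
    intro v
    simp [U, Submodule.mem_iInf, sub_eq_zero]
  have hinv : ∀ g, ∀ v ∈ U, ρ g v ∈ U := by
    intro g v hv
    rw [hU] at hv ⊢
    intro m hm
    obtain ⟨n, hn, h1⟩ := hnormal g⁻¹ m hm
    have h2 : ρ m * ρ g = ρ g * ρ n := by
      rw [← h1, ← map_mul, ← map_mul]
      congr 1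
      group
    rw [← Module.End.mul_apply, h2, Module.End.mul_apply, hv n hn]
  rcases ((isIrreducible_iff_forall_submodule ρ).1 hρ).2 U hinv with h | h
  · intro v hv
    have : v ∈ U := (hU v).2 hv
    rwa [h, Submodule.mem_bot] at this
  · obtain ⟨m, hm, hm1⟩ := hker
    refine absurd ?_ hm1
    ext1 v
    exact (hU v).1 (h ▸ Submodule.mem_top) m hm

end FixedPointFree

end Representation

/-! ### Primes that do not divide a codegree -/

section Codegree

variable {G : Type*} [Group G] [Finite G] {n : ℕ} (ρ : Representation ℂ G (Fin n → ℂ))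

theorem codegree_mul_finrank (hρ : ρ.IsIrreducible) :
    codegree ρ * finrank ℂ (Fin n → ℂ) = (MonoidHom.ker ρ).index :=
  Nat.div_mul_cancel (hρ.finrank_dvd_index_ker ρ)

theorem codegree_dvd_index_ker (hρ : ρ.IsIrreducible) : codegree ρ ∣ (MonoidHom.ker ρ).index :=
  Dvd.intro _ (codegree_mul_finrank ρ hρ)

theorem codegree_dvd_card (hρ : ρ.IsIrreducible) : codegree ρ ∣ Nat.card G :=
  (codegree_dvd_index_ker ρ hρ).trans (Subgroup.index_dvd_card _)

theorem not_dvd_codegree_of_le_ker (hρ : ρ.IsIrreducible) {p : ℕ} {M : Subgroup G}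
    (hM : M ≤ MonoidHom.ker ρ) (hp : ¬ p ∣ M.index) : ¬ p ∣ codegree ρ := fun h =>
  hp ((h.trans (codegree_dvd_index_ker ρ hρ)).trans (Subgroup.index_dvd_of_le hM))

/-- Otherwise `p²` divides `cod(χ) χ(1) = |G : ker χ|`, and hence `|G|`. -/
theorem not_dvd_codegree_of_dvd_finrank (hρ : ρ.IsIrreducible) {p t : ℕ} (hp0 : 0 < p)
    (hdvd : p ∣ finrank ℂ (Fin n → ℂ)) (hcard : Nat.card G = p * t) (ht : ¬ p ∣ t) :
    ¬ p ∣ codegree ρ := by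
  intro h
  have h1 : p * p ∣ p * t := by
    rw [← hcard]
    exact (mul_dvd_mul h hdvd).trans
      (codegree_mul_finrank ρ hρ ▸ Subgroup.index_dvd_card (MonoidHom.ker ρ))
  exact ht (Nat.dvd_of_mul_dvd_mul_left hp0 h1)

end Codegree

noncomputable section

/-! ### The linear characters and `σᶜ` -/

namespace Representation

/-- The representation of degree one afforded by a linear character. -/
def ofLinearCharacter {G : Type*} [Group G] (χ : G →* ℂ) : Representation ℂ G (Fin 1 → ℂ) :=
  (Algebra.ofId ℂ (End ℂ (Fin 1 → ℂ)) : ℂ →* End ℂ (Fin 1 → ℂ)).comp χ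

variable {G : Type*} [Group G] (χ : G →* ℂ)

theorem isIrreducible_ofLinearCharacter : (ofLinearCharacter χ).IsIrreducible := by
  rw [isIrreducible_iff_forall_submodule]
  have : IsSimpleOrder (Submodule ℂ (Fin 1 → ℂ)) :=
    is_simple_module_of_finrank_eq_one (finrank_fin_fun ℂ)
  exact ⟨inferInstance, fun U _ => eq_bot_or_eq_top U⟩

theorem mem_ker_ofLinearCharacter {g : G} :
    g ∈ MonoidHom.ker (ofLinearCharacter χ) ↔ χ g = 1 := by
  rw [MonoidHom.mem_ker]
  constructor
  · intro h
    have h1 := congrFun (congrArg (fun f : End ℂ (Fin 1 → ℂ) => f 1) h) 0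
    simpa [ofLinearCharacter, Algebra.ofId_apply] using h1
  · intro h
    simp [ofLinearCharacter, h]

/-- The codegree of a linear character is the index of its kernel, and `g` has order `p` modulo the
kernel. -/
theorem prime_dvd_codegree_ofLinearCharacter {p : ℕ} (hp : p.Prime) {g : G} (hg : g ^ p = 1)
    (hχ : χ g ≠ 1) : p ∣ codegree (ofLinearCharacter χ) := by
  have h1 : orderOf (g : G ⧸ MonoidHom.ker (ofLinearCharacter χ)) = p := by
    have := Fact.mk hp
    refine orderOf_eq_prime ?_ fun h => hχ ?_
    · rw [← QuotientGroup.mk_pow, hg, QuotientGroup.mk_one]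
    · rwa [QuotientGroup.eq_one_iff, mem_ker_ofLinearCharacter] at h
  have h2 : codegree (ofLinearCharacter χ) = (MonoidHom.ker (ofLinearCharacter χ)).index := by
    simp [codegree]
  rw [h2, ← h1]
  exact orderOf_dvd_natCard _

end Representation

/-- The lower bound needs one linear character only. Exhibiting a greatest element also takes care
of the boundedness that `sSup` on `ℕ` requires. -/
theorem sigmaCod_eq {G : Type*} [Group G] [Finite G] {N : ℕ}
    (hle : ∀ (n : ℕ) (ρ : Representation ℂ G (Fin n → ℂ)), ρ.IsIrreducible →
      (codegree ρ).primeFactors.card ≤ N) (χ : G →* ℂ) (P : Finset ℕ) (hP : N ≤ P.card)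
    (h : ∀ p ∈ P, p.Prime ∧ ∃ g, g ^ p = 1 ∧ χ g ≠ 1) : sigmaCod G = N := by
  have hirr := Representation.isIrreducible_ofLinearCharacter χ
  refine IsGreatest.csSup_eq ⟨⟨_, ⟨1, _, hirr, rfl⟩, le_antisymm ?_ (hle 1 _ hirr)⟩, ?_⟩
  · refine hP.trans (Finset.card_le_card fun p hp => ?_)
    obtain ⟨hprime, g, hg, hχ⟩ := h p hp
    refine Nat.mem_primeFactors.2 ⟨hprime,
      Representation.prime_dvd_codegree_ofLinearCharacter χ hprime hg hχ, ?_⟩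
    exact ne_zero_of_dvd_ne_zero Nat.card_pos.ne' (codegree_dvd_card _ hirr)
  · rintro m ⟨c, ⟨n, ρ, hρ, rfl⟩, rfl⟩
    exact hle n ρ hρ

theorem eq_one_of_pow_eq_one_of_coprime {M : Type*} [Monoid M] {x : M} {m n : ℕ}
    (hmn : m.Coprime n) (hm : x ^ m = 1) (hn : x ^ n = 1) : x = 1 :=
  orderOf_eq_one_iff.1 (Nat.dvd_one.1
    (hmn ▸ Nat.dvd_gcd (orderOf_dvd_of_pow_eq_one hm) (orderOf_dvd_of_pow_eq_one hn)))

theorem Multiplicative.pow_zmod_eq_one {n : ℕ} (x : Multiplicative (ZMod n)) : x ^ n = 1 :=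
  congrArg Multiplicative.ofAdd (show n • Multiplicative.toAdd x = 0 by simp)

theorem map_mem_of_mulSingle_mem {H : Type*} [Group H] {M : Fin 4 → Type*} [∀ i, CommGroup (M i)]
    (f : (∀ i, M i) →* H) (K : Subgroup H) (x : ∀ i, M i)
    (h : ∀ i, f (Pi.mulSingle i (x i)) ∈ K) : f x ∈ K := by
  have h1 : x ∈ K.comap f := by
    rw [← Finset.univ_prod_mulSingle x]
    exact Subgroup.prod_mem _ fun i _ => h i
  exact h1

theorem card_subtype_imp_eq_one {M : Type*} [One M] (p : Prop) [Decidable p] :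
    Nat.card {x : M // ¬ p → x = 1} = if p then Nat.card M else 1 := by
  split_ifs with h
  · exact Nat.card_congr (Equiv.subtypeUnivEquiv fun _ h' => absurd h h')
  · simp [h]

/-! ### Normality of the factors `R_j` in `L` -/

namespace TopData

variable (D : TopData)

instance (i : Fin 4) : Fact (D.q i).Prime := ⟨D.q_prime i⟩

instance (j : Fin 4) : Fact (D.r j).Prime := ⟨D.r_prime j⟩

theorem q_injective : Function.Injective D.q := D.distinct.comp Sum.inl_injective

theorem r_injective : Function.Injective D.r := D.distinct.comp Sum.inr_injective

theorem coprime_r {i j : Fin 4} (h : i ≠ j) : (D.r i).Coprime (D.r j) :=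
  (Nat.coprime_primes (D.r_prime i) (D.r_prime j)).2 (D.r_injective.ne h)

/-- An element with trivial `j`-th component is killed by the product of the other `r_i`, and so is
its image under any automorphism; this product is coprime to `r_j`. No formula for `φ` is needed. -/
theorem φ_apply_eq_one (x : ∀ i, Multiplicative (ZMod (D.q i)))
    (a : ∀ j, Multiplicative (ZMod (D.r j))) (j : Fin 4) (h : a j = 1) : D.φ x a j = 1 := by
  have ha : a ^ (∏ i ∈ Finset.univ.erase j, D.r i) = 1 := by
    funext i
    rcases eq_or_ne i j with rfl | hi
    · simp [h]
    · obtain ⟨t, ht⟩ := Finset.dvd_prod_of_mem D.r (Finset.mem_erase.2 ⟨hi, Finset.mem_univ i⟩)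
      rw [ht, Pi.pow_apply, pow_mul, Multiplicative.pow_zmod_eq_one, one_pow, Pi.one_apply]
  refine eq_one_of_pow_eq_one_of_coprime (Nat.Coprime.prod_right
    (t := Finset.univ.erase j) (s := D.r) fun i hi => D.coprime_r (Finset.ne_of_mem_erase hi).symm)
    (Multiplicative.pow_zmod_eq_one _) ?_
  rw [← Pi.pow_apply, ← map_pow, ha, map_one, Pi.one_apply]

theorem exists_φ_mulSingle (x : ∀ i, Multiplicative (ZMod (D.q i))) (j : Fin 4)
    (y : Multiplicative (ZMod (D.r j))) : ∃ y', D.φ x (Pi.mulSingle j y) = Pi.mulSingle j y' := by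
  refine ⟨D.φ x (Pi.mulSingle j y) j, funext fun i => ?_⟩
  rcases eq_or_ne i j with rfl | hi
  · simp
  · rw [Pi.mulSingle_eq_of_ne hi, φ_apply_eq_one _ _ _ _ (Pi.mulSingle_eq_of_ne hi _)]

/-- The product of the `R_j` is abelian, so only the component of `l` in the product of the `Q_i`
matters. -/
theorem exists_conj_ιR (l : D.L) (j : Fin 4) (y : Multiplicative (ZMod (D.r j))) :
    ∃ y', l * D.ιR j y * l⁻¹ = D.ιR j y' := by
  obtain ⟨y', hy'⟩ := D.exists_φ_mulSingle l.right j y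
  refine ⟨y', ?_⟩
  have h : l * D.ιR j y * l⁻¹ = SemidirectProduct.inl (D.φ l.right (Pi.mulSingle j y)) := by
    ext1
    · simp [ιR, mul_comm]
    · simp [ιR]
  rw [h, hy']
  rfl

end TopData

/-! ### The primes and the orders of the factors -/

namespace ExampleData

variable (E : ExampleData)

instance (k : Fin 4) : Fact (E.s k).Prime := E.s_prime k

theorem d_pos (k : Fin 4) : 0 < E.d k := by
  have h := ((Representation.isIrreducible_iff_forall_submodule _).1 (E.irreducible k)).1
  by_contra h0
  have : IsEmpty (Fin (E.d k)) := ⟨fun x => h0 x.pos⟩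
  exact not_subsingleton _ (inferInstance : Subsingleton (Fin (E.d k) → ZMod (E.s k)))

/-- The primes that belong to the subgroups `Q_i`, `R_j`, `V_k`. -/
def factorPrime : Fin 4 ⊕ Fin 4 ⊕ Fin 4 → ℕ := Sum.elim E.q (Sum.elim E.r E.s)

/-- The logarithms of the orders of the subgroups `Q_i`, `R_j`, `V_k`. -/
def factorRank : Fin 4 ⊕ Fin 4 ⊕ Fin 4 → ℕ := Sum.elim 1 (Sum.elim 1 E.d)

/-- The subgroups `Q_i`, `R_j`, `V_k`, as one family. -/
def factor : Fin 4 ⊕ Fin 4 ⊕ Fin 4 → Subgroup E.G := Sum.elim E.Q (Sum.elim E.R E.V)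

theorem factorPrime_prime : ∀ a, (E.factorPrime a).Prime
  | .inl i => E.q_prime i
  | .inr (.inl j) => E.r_prime j
  | .inr (.inr k) => (E.s_prime k).out

theorem factorRank_pos : ∀ a, 0 < E.factorRank a
  | .inl _ => one_pos
  | .inr (.inl _) => one_pos
  | .inr (.inr k) => E.d_pos k

theorem ne_s_of_dvd {p : ℕ} (hp : p.Prime) {k : Fin 4} (h : p ∣ E.s k - 1) : p ≠ E.s k := by
  rintro rfl
  have := Nat.le_of_dvd (Nat.sub_pos_of_lt (E.s_prime k).out.one_lt) h
  have := hp.pos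
  omega

theorem q_ne_s (i k : Fin 4) : E.q i ≠ E.s k :=
  E.ne_s_of_dvd (E.q_prime i) (((Finset.dvd_prod_of_mem _ (Finset.mem_univ i)).trans
    (Dvd.intro _ rfl)).trans (E.dvd_s k))

theorem r_ne_s (j k : Fin 4) : E.r j ≠ E.s k :=
  E.ne_s_of_dvd (E.r_prime j) (((Finset.dvd_prod_of_mem _ (Finset.mem_univ j)).trans
    (Dvd.intro_left _ rfl)).trans (E.dvd_s k))

theorem factorPrime_injective : Function.Injective E.factorPrime := by
  have hqr : ∀ i j, E.q i ≠ E.r j := fun i j h =>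
    Sum.inl_ne_inr (E.distinct (a₁ := .inl i) (a₂ := .inr j) h)
  rintro (i | j | k) (i' | j' | k') h
  · exact congrArg _ (E.q_injective h)
  · exact (hqr _ _ h).elim
  · exact (E.q_ne_s _ _ h).elim
  · exact (hqr _ _ h.symm).elim
  · exact congrArg _ (congrArg _ (E.r_injective h))
  · exact (E.r_ne_s _ _ h).elim
  · exact (E.q_ne_s _ _ h.symm).elim
  · exact (E.r_ne_s _ _ h.symm).elim
  · exact congrArg _ (congrArg _ (E.s_injective h))

/-! ### The subgroups generated by some of the `Q_i`, `R_j`, `V_k` -/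

/-- The subgroup generated by the `Q_i`, `R_j`, `V_k` with index in `F`. -/
def block (F : Finset (Fin 4 ⊕ Fin 4 ⊕ Fin 4)) : Subgroup E.G where
  carrier := {g | (∀ i, .inl i ∉ F → g.right.right i = 1) ∧
    (∀ j, .inr (.inl j) ∉ F → g.right.left j = 1) ∧
    ∀ k, .inr (.inr k) ∉ F → g.left k = 1}
  one_mem' := ⟨fun _ _ => rfl, fun _ _ => rfl, fun _ _ => rfl⟩
  mul_mem' := by
    rintro a b ⟨ha, ha', ha''⟩ ⟨hb, hb', hb''⟩
    refine ⟨fun i hi => ?_, fun j hj => ?_, fun k hk => ?_⟩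
    · simp [ha i hi, hb i hi]
    · simp [ha' j hj, E.φ_apply_eq_one _ _ j (hb' j hj)]
    · simp [ha'' k hk, ψ, hb'' k hk]
  inv_mem' := by
    rintro a ⟨ha, ha', ha''⟩
    refine ⟨fun i hi => ?_, fun j hj => ?_, fun k hk => ?_⟩
    · simp [ha i hi]
    · simp only [SemidirectProduct.inv_right, SemidirectProduct.inv_left]
      exact E.φ_apply_eq_one _ _ j (by simp [ha' j hj])
    · simp [ψ, ha'' k hk]

variable {E} {F : Finset (Fin 4 ⊕ Fin 4 ⊕ Fin 4)}

theorem factor_le_block : ∀ {a}, a ∈ F → E.factor a ≤ E.block F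
  | .inl i, ha => by
    rintro _ ⟨x, rfl⟩
    refine ⟨fun i' hi' => Pi.mulSingle_eq_of_ne ?_ _, fun _ _ => rfl, fun _ _ => rfl⟩
    rintro rfl
    exact hi' ha
  | .inr (.inl j), ha => by
    rintro _ ⟨x, rfl⟩
    refine ⟨fun _ _ => rfl, fun j' hj' => Pi.mulSingle_eq_of_ne ?_ _, fun _ _ => rfl⟩
    rintro rfl
    exact hj' ha
  | .inr (.inr k), ha => by
    rintro _ ⟨x, rfl⟩
    refine ⟨fun _ _ => rfl, fun _ _ => rfl, fun k' hk' => Pi.mulSingle_eq_of_ne ?_ _⟩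
    rintro rfl
    exact hk' ha

/-- Every element is the product of its components, taken in the order `V`, `R`, `Q`. Together with
`factor_le_block` this identifies the block with the subgroup generated by its factors. -/
theorem block_le {K : Subgroup E.G} (h : ∀ a ∈ F, E.factor a ≤ K) : E.block F ≤ K := by
  rintro g ⟨hQ, hR, hV⟩
  rw [← SemidirectProduct.inl_left_mul_inr_right g,
    ← SemidirectProduct.inl_left_mul_inr_right g.right, map_mul]
  refine K.mul_mem ?_ (K.mul_mem ?_ ?_)
  · refine map_mem_of_mulSingle_mem _ _ _ fun k => ?_
    by_cases hk : .inr (.inr k) ∈ F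
    · exact h _ hk ⟨g.left k, rfl⟩
    · rw [hV k hk, Pi.mulSingle_one, map_one]
      exact K.one_mem
  · refine map_mem_of_mulSingle_mem ((SemidirectProduct.inr : E.L →* E.G).comp
      SemidirectProduct.inl) _ _ fun j => ?_
    by_cases hj : .inr (.inl j) ∈ F
    · exact h _ hj ⟨g.right.left j, rfl⟩
    · rw [hR j hj, Pi.mulSingle_one, map_one]
      exact K.one_mem
  · refine map_mem_of_mulSingle_mem ((SemidirectProduct.inr : E.L →* E.G).comp
      SemidirectProduct.inr) _ _ fun i => ?_
    by_cases hi : .inl i ∈ F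
    · exact h _ hi ⟨g.right.right i, rfl⟩
    · rw [hQ i hi, Pi.mulSingle_one, map_one]
      exact K.one_mem

instance : Finite E.G := by
  have : Finite E.L := Finite.of_equiv _ SemidirectProduct.equivProd.symm
  have (k : Fin 4) : Finite (Multiplicative (Fin (E.d k) → ZMod (E.s k))) :=
    inferInstanceAs (Finite (Fin (E.d k) → ZMod (E.s k)))
  exact Finite.of_equiv _ SemidirectProduct.equivProd.symm

variable (E F) in
theorem card_block : Nat.card (E.block F) = ∏ a ∈ F, E.factorPrime a ^ E.factorRank a := by
  let e : E.block F ≃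
      (∀ i, {x : Multiplicative (ZMod (E.q i)) // ¬ .inl i ∈ F → x = 1}) ×
      (∀ j, {x : Multiplicative (ZMod (E.r j)) // ¬ .inr (.inl j) ∈ F → x = 1}) ×
      ∀ k, {x : Multiplicative (Fin (E.d k) → ZMod (E.s k)) // ¬ .inr (.inr k) ∈ F → x = 1} :=
    { toFun := fun g => ⟨fun i => ⟨g.1.right.right i, g.2.1 i⟩,
        fun j => ⟨g.1.right.left j, g.2.2.1 j⟩, fun k => ⟨g.1.left k, g.2.2.2 k⟩⟩
      invFun := fun x => ⟨⟨fun k => (x.2.2 k).1, ⟨fun j => (x.2.1 j).1, fun i => (x.1 i).1⟩⟩,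
        fun i => (x.1 i).2, fun j => (x.2.1 j).2, fun k => (x.2.2 k).2⟩
      left_inv := fun _ => rfl
      right_inv := fun _ => rfl }
  rw [Nat.card_congr e, Nat.card_prod, Nat.card_prod, Nat.card_pi, Nat.card_pi, Nat.card_pi,
    show ∏ a ∈ F, E.factorPrime a ^ E.factorRank a =
      ∏ a, if a ∈ F then E.factorPrime a ^ E.factorRank a else 1 by simp,
    Fintype.prod_sum_type, Fintype.prod_sum_type]
  simp only [card_subtype_imp_eq_one]
  simp [factorPrime, factorRank]

theorem card_factor : ∀ a, Nat.card (E.factor a) = E.factorPrime a ^ E.factorRank a := by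
  intro a
  have h : E.factor a = E.block {a} := by
    refine le_antisymm (factor_le_block (Finset.mem_singleton_self a)) (block_le fun b hb => ?_)
    rw [Finset.mem_singleton.1 hb]
  rw [h, card_block, Finset.prod_singleton]

variable (E F) in
theorem primeFactors_card_block :
    (Nat.card (E.block F)).primeFactors = F.image E.factorPrime := by
  ext p
  rw [Nat.mem_primeFactors, Finset.mem_image, card_block]
  constructor
  · rintro ⟨hp, h, -⟩
    obtain ⟨a, ha, h⟩ := (hp.prime.dvd_finsetProd_iff _).1 h
    exact ⟨a, ha, ((Nat.prime_dvd_prime_iff_eq hp (E.factorPrime_prime a)).1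
      (hp.dvd_of_dvd_pow h)).symm⟩
  · rintro ⟨a, ha, rfl⟩
    refine ⟨E.factorPrime_prime a, (dvd_pow_self _ (E.factorRank_pos a).ne').trans
      (Finset.dvd_prod_of_mem (fun b => E.factorPrime b ^ E.factorRank b) ha), ?_⟩
    exact Finset.prod_ne_zero_iff.2 fun b _ => pow_ne_zero _ (E.factorPrime_prime b).ne_zero

variable (E F) in
theorem card_primeSet_block : (primeSet (E.block F)).card = F.card := by
  rw [primeSet, primeFactors_card_block, Finset.card_image_of_injective _ E.factorPrime_injective]

-- Distinct factors belong to distinct primes, so each factor is a Sylow subgroup of the block.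
variable (E) in
theorem exists_card_block_eq_mul {a} (ha : a ∈ F) :
    ∃ t, Nat.card (E.block F) = E.factorPrime a ^ E.factorRank a * t ∧ ¬ E.factorPrime a ∣ t := by
  refine ⟨∏ b ∈ F.erase a, E.factorPrime b ^ E.factorRank b, ?_, fun h => ?_⟩
  · rw [card_block, Finset.mul_prod_erase F (fun b => E.factorPrime b ^ E.factorRank b) ha]
  · obtain ⟨b, hb, h⟩ := ((E.factorPrime_prime a).prime.dvd_finsetProd_iff _).1 h
    have h1 := (Nat.prime_dvd_prime_iff_eq (E.factorPrime_prime a) (E.factorPrime_prime b)).1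
      ((E.factorPrime_prime a).dvd_of_dvd_pow h)
    exact Finset.ne_of_mem_erase hb (E.factorPrime_injective h1).symm

/-! ### Fixed point free action among the factors -/

variable (E) in
/-- The factor with index `a` acts fixed point freely on the one with index `b`. -/
def ActsFPF (a b : Fin 4 ⊕ Fin 4 ⊕ Fin 4) : Prop :=
  ∀ x ∈ E.factor a, ∀ m ∈ E.factor b,
    x * m * x⁻¹ ∈ E.factor b ∧ (x ≠ 1 → x * m = m * x → m = 1)

theorem actsFPF_Q_R {i j : Fin 4} (h : j ∈ fpfIndices i) : E.ActsFPF (.inl i) (.inr (.inl j)) := by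
  rintro _ ⟨x, rfl⟩ _ ⟨y, rfl⟩
  have hconj : E.ιQ i x * E.ιR j y * (E.ιQ i x)⁻¹ =
      SemidirectProduct.inl (E.φ (Pi.mulSingle i x) (Pi.mulSingle j y)) := by
    simp [TopData.ιQ, TopData.ιR, SemidirectProduct.inl_aut]
  simp only [MonoidHom.comp_apply, ← map_mul, ← map_inv]
  constructor
  · obtain ⟨y', hy'⟩ := E.exists_conj_ιR (E.ιQ i x) j y
    rw [map_inv, hy']
    exact ⟨y', rfl⟩
  · intro hx hxy
    rw [SemidirectProduct.inr_injective.eq_iff, ← mul_inv_eq_iff_eq_mul, hconj] at hxy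
    have hy : y = 1 := by
      by_contra hy
      refine E.acts_fpf i j h x ?_ y hy (SemidirectProduct.inl_injective hxy)
      rintro rfl
      simp at hx
    simp [hy]

theorem conj_V (l : E.L) (k : Fin 4) (v : Multiplicative (Fin (E.d k) → ZMod (E.s k))) :
    (SemidirectProduct.inr l * SemidirectProduct.inl (Pi.mulSingle k v) *
      (SemidirectProduct.inr l)⁻¹ : E.G) = SemidirectProduct.inl (Pi.mulSingle k
        (Multiplicative.ofAdd (E.ρ k l (Multiplicative.toAdd v)))) := by
  rw [← map_inv, ← SemidirectProduct.inl_aut]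
  congr 1
  funext k'
  rcases eq_or_ne k' k with rfl | hk
  · simp [ψ]
  · simp [ψ, Pi.mulSingle_eq_of_ne hk]

/-- `V_k` is normal in the whole of `G`: `L` preserves it and the product of all `V_k` is abelian.
-/
theorem conj_mem_V (g : E.G) {k : Fin 4} {m : E.G} (hm : m ∈ E.V k) : g * m * g⁻¹ ∈ E.V k := by
  obtain ⟨v, rfl⟩ := hm
  refine ⟨Multiplicative.ofAdd (E.ρ k g.right (Multiplicative.toAdd v)), ?_⟩
  have h := conj_V g.right k v
  simp only [MonoidHom.comp_apply, MonoidHom.mulSingle_apply]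
  rw [← h]
  conv_rhs => rw [← SemidirectProduct.inl_left_mul_inr_right g, mul_inv_rev]
  have h2 : (SemidirectProduct.inl g.left * SemidirectProduct.inr g.right *
      SemidirectProduct.inl (Pi.mulSingle k v) * ((SemidirectProduct.inr g.right)⁻¹ *
      (SemidirectProduct.inl g.left)⁻¹) : E.G) = SemidirectProduct.inl g.left *
      (SemidirectProduct.inr g.right * SemidirectProduct.inl (Pi.mulSingle k v) *
      (SemidirectProduct.inr g.right)⁻¹) * (SemidirectProduct.inl g.left)⁻¹ := by group
  rw [h2, h, ← map_mul, ← map_inv, ← map_mul, mul_inv_cancel_comm]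

theorem V_fpf {l : E.L} {k : Fin 4} (hl : ∀ v, E.ρ k l v = v → v = 0) {m : E.G} (hm : m ∈ E.V k)
    (h : SemidirectProduct.inr l * m = m * SemidirectProduct.inr l) : m = 1 := by
  obtain ⟨v, rfl⟩ := hm
  simp only [MonoidHom.comp_apply, MonoidHom.mulSingle_apply] at h ⊢
  rw [← mul_inv_eq_iff_eq_mul, conj_V] at h
  have h1 := Pi.mulSingle_injective k (SemidirectProduct.inl_injective h)
  have h2 : v = 1 := hl _ h1
  simp [h2]

theorem actsFPF_Q_V {i k : Fin 4} (h : i ∉ blockIndices k) :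
    E.ActsFPF (.inl i) (.inr (.inr k)) := by
  rintro _ ⟨x, rfl⟩ m hm
  refine ⟨conj_mem_V _ hm, fun hx => V_fpf (E.Q_fpf k i h x ?_) hm⟩
  rintro rfl
  simp at hx

theorem actsFPF_R_V {j k : Fin 4} (h : j ∈ blockIndices k) :
    E.ActsFPF (.inr (.inl j)) (.inr (.inr k)) := by
  rintro _ ⟨x, rfl⟩ m hm
  refine ⟨conj_mem_V _ hm, fun hx => V_fpf (E.R_fpf k _ ?_ ?_) hm⟩
  · exact Subgroup.mem_iSup_of_mem j (Subgroup.mem_iSup_of_mem h ⟨x, rfl⟩)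
  · intro h
    simp [h] at hx

/-! ### Codegrees of the blocks -/

section Codegree

variable {n : ℕ} (ρ : Representation ℂ (E.block F) (Fin n → ℂ))

/-- The kernel of a representation of a block, as a subgroup of `G`. -/
def kerBlock : Subgroup E.G := (MonoidHom.ker ρ).map (E.block F).subtype

variable {ρ}

theorem mem_kerBlock {g : E.G} (hg : g ∈ E.block F) : g ∈ kerBlock ρ ↔ ρ ⟨g, hg⟩ = 1 := by
  simp [kerBlock, MonoidHom.mem_ker, hg]

/-- The factor is a Sylow subgroup, so its index, a multiple of the index of the kernel, is prime to
`factorPrime a`. -/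
theorem not_dvd_codegree_of_factor_le_kerBlock (hρ : ρ.IsIrreducible) {a} (ha : a ∈ F)
    (h : E.factor a ≤ kerBlock ρ) : ¬ E.factorPrime a ∣ codegree ρ := by
  obtain ⟨t, ht, hdvd⟩ := E.exists_card_block_eq_mul ha
  refine not_dvd_codegree_of_le_ker ρ hρ (M := (E.factor a).subgroupOf (E.block F)) ?_ ?_
  · intro x hx
    exact (mem_kerBlock x.2).1 (h hx)
  · have h1 := ((E.factor a).subgroupOf (E.block F)).card_mul_index
    rw [ht, Nat.card_congr (Subgroup.subgroupOfEquivOfLe (factor_le_block ha)).toEquiv,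
      card_factor] at h1
    rwa [Nat.eq_of_mul_eq_mul_left (pow_pos (E.factorPrime_prime a).pos _) h1]

/-- By the fixed point free action the prime of `a` divides the degree; rank 1 ensures that it
divides the order of the block only once. In `hnormal`, the factor `w` expresses normality modulo
the kernel. -/
theorem not_dvd_codegree_of_actsFPF (hρ : ρ.IsIrreducible) {a b} (ha : a ∈ F) (hb : b ∈ F)
    (hrank : E.factorRank a = 1) (hab : E.ActsFPF a b) (hker : ¬ E.factor b ≤ kerBlock ρ)
    (hnormal : ∀ g ∈ E.block F, ∀ m ∈ E.factor b, ∃ n ∈ E.factor b, ∃ w ∈ kerBlock ρ,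
      g * m * g⁻¹ = w * n) : ¬ E.factorPrime a ∣ codegree ρ := by
  obtain ⟨t, ht, hdvd⟩ := E.exists_card_block_eq_mul ha
  rw [hrank, pow_one] at ht
  refine not_dvd_codegree_of_dvd_finrank ρ hρ (E.factorPrime_prime a).pos ?_ ht hdvd
  have hcard : Nat.card ((E.factor a).subgroupOf (E.block F)) = E.factorPrime a := by
    rw [Nat.card_congr (Subgroup.subgroupOfEquivOfLe (factor_le_block ha)).toEquiv,
      card_factor, hrank, pow_one]
  rw [← hcard]
  refine hρ.card_dvd_finrank_of_fpf ρ _ ((E.factor b).subgroupOf (E.block F)) ?_ ?_ ?_ ?_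
  · intro g m hm
    obtain ⟨n, hn, w, hw, h⟩ := hnormal g g.2 m hm
    have hn' := factor_le_block hb hn
    obtain ⟨w, hw, rfl⟩ := hw
    refine ⟨⟨n, hn'⟩, hn, ?_⟩
    have h1 : g * m * g⁻¹ = w * ⟨n, hn'⟩ := Subtype.ext h
    rw [h1, map_mul, MonoidHom.mem_ker.1 hw, one_mul]
  · obtain ⟨m, hm, hm'⟩ := SetLike.not_le_iff_exists.1 hker
    exact ⟨⟨m, factor_le_block hb hm⟩, hm, fun h => hm' ((mem_kerBlock _).2 h)⟩
  · exact fun x hx m hm => (hab x hx m hm).1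
  · exact fun x hx hx1 m hm h => Subtype.ext
      ((hab x hx m hm).2 (fun h => hx1 (Subtype.ext h)) (congrArg Subtype.val h))

theorem not_dvd_codegree_of_actsFPF_V (hρ : ρ.IsIrreducible) {a k} (ha : a ∈ F)
    (hk : .inr (.inr k) ∈ F) (hrank : E.factorRank a = 1) (hab : E.ActsFPF a (.inr (.inr k)))
    (hker : ¬ E.V k ≤ kerBlock ρ) : ¬ E.factorPrime a ∣ codegree ρ :=
  not_dvd_codegree_of_actsFPF hρ ha hk hrank hab hker fun g _ _ hm =>
    ⟨_, conj_mem_V g hm, 1, one_mem _, (one_mul _).symm⟩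

/-- `R_j` is normal in `L` but not in general in the block: conjugation by an element of the `V_k`
produces commutators in those `V_k` on which `R_j` acts non-trivially. By `hV` these lie in the
kernel. -/
theorem not_dvd_codegree_of_actsFPF_R (hρ : ρ.IsIrreducible) {a j} (ha : a ∈ F)
    (hj : .inr (.inl j) ∈ F) (hrank : E.factorRank a = 1) (hab : E.ActsFPF a (.inr (.inl j)))
    (hker : ¬ E.R j ≤ kerBlock ρ)
    (hV : ∀ k, .inr (.inr k) ∈ F → j ∈ blockIndices k → E.V k ≤ kerBlock ρ) :
    ¬ E.factorPrime a ∣ codegree ρ := by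
  refine not_dvd_codegree_of_actsFPF hρ ha hj hrank hab hker ?_
  rintro g hg _ ⟨y, rfl⟩
  obtain ⟨y', hy'⟩ := E.exists_conj_ιR g.right j y
  -- This is the commutator of `g.left` with the element `y'` of `R_j`.
  let w : ∀ k, Multiplicative (Fin (E.d k) → ZMod (E.s k)) :=
    g.left * (E.ψ (E.ιR j y') g.left)⁻¹
  refine ⟨_, ⟨y', rfl⟩, SemidirectProduct.inl w, ?_, ?_⟩
  · refine map_mem_of_mulSingle_mem _ _ _ fun k => ?_
    have hw : w k = g.left k * (Multiplicative.ofAdd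
      (E.ρ k (E.ιR j y') (Multiplicative.toAdd (g.left k))))⁻¹ := rfl
    by_cases hk : .inr (.inr k) ∈ F
    · by_cases hjk : j ∈ blockIndices k
      · exact hV k hk hjk ⟨w k, rfl⟩
      · have h1 : w k = 1 := by simp [hw, E.R_trivial k j hjk]
        rw [h1, Pi.mulSingle_one, map_one]
        exact one_mem _
    · have h1 : w k = 1 := by simp [hw, hg.2.2 k hk]
      rw [h1, Pi.mulSingle_one, map_one]
      exact one_mem _
  · rw [mul_inv_eq_iff_eq_mul]
    have h1 : g.right * E.ιR j y = E.ιR j y' * g.right := by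
      rw [← hy', inv_mul_cancel_right]
    ext1
    · simp [w]
    · simpa using h1

theorem card_primeFactors_codegree_le (hρ : ρ.IsIrreducible) (S : Finset (Fin 4 ⊕ Fin 4 ⊕ Fin 4))
    (hS : ∀ a ∈ S, ¬ E.factorPrime a ∣ codegree ρ) {N : ℕ} (hN : (F \ S).card ≤ N) :
    (codegree ρ).primeFactors.card ≤ N := by
  refine le_trans (Finset.card_le_card ?_)
    ((Finset.card_image_le (s := F \ S) (f := E.factorPrime)).trans hN)
  intro p hp
  have h1 := Nat.primeFactors_mono (codegree_dvd_card ρ hρ) Nat.card_pos.ne' hp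
  rw [primeFactors_card_block] at h1
  obtain ⟨a, ha, rfl⟩ := Finset.mem_image.1 h1
  exact Finset.mem_image_of_mem _ (Finset.mem_sdiff.2
    ⟨ha, fun h => hS a h (Nat.dvd_of_mem_primeFactors hp)⟩)

end Codegree

variable (E) in
/-- The linear character of `G` that is faithful on every `Q_i`. -/
def linearCharacter : E.G →* ℂ where
  toFun g := ∏ i, ZMod.stdAddChar (Multiplicative.toAdd (g.right.right i))
  map_one' := Finset.prod_eq_one fun i _ => AddChar.map_zero_eq_one _
  map_mul' g h := by simp [AddChar.map_add_eq_mul, Finset.prod_mul_distrib]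

/-- The linear character of `G`, restricted to the block, is non-trivial on the generator of `Q_i`
for every `i ∈ I`. -/
theorem sigmaCod_block {N : ℕ}
    (hle : ∀ (n : ℕ) (ρ : Representation ℂ (E.block F) (Fin n → ℂ)), ρ.IsIrreducible →
      (codegree ρ).primeFactors.card ≤ N) (I : Finset (Fin 4)) (hI : I.image .inl ⊆ F)
    (hN : N ≤ I.card) : sigmaCod (E.block F) = N := by
  refine sigmaCod_eq hle (E.linearCharacter.comp (E.block F).subtype) (I.image E.q)
    (by rwa [Finset.card_image_of_injective _ E.q_injective]) fun p hp => ?_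
  obtain ⟨i, hi, rfl⟩ := Finset.mem_image.1 hp
  refine ⟨E.q_prime i, ⟨SemidirectProduct.inr (E.ιQ i (Multiplicative.ofAdd 1)),
    factor_le_block (hI (Finset.mem_image_of_mem _ hi)) ⟨_, rfl⟩⟩, ?_, ?_⟩
  · refine Subtype.ext ?_
    simp only [Subgroup.coe_pow, ← map_pow, Multiplicative.pow_zmod_eq_one, map_one,
      Subgroup.coe_one]
  · have h1 : E.linearCharacter (SemidirectProduct.inr (E.ιQ i (Multiplicative.ofAdd 1))) =
        ZMod.stdAddChar (1 : ZMod (E.q i)) := by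
      change ∏ i', ZMod.stdAddChar (Multiplicative.toAdd ((Pi.mulSingle i (Multiplicative.ofAdd 1) :
        ∀ i', Multiplicative (ZMod (E.q i'))) i')) = _
      rw [Finset.prod_eq_single i]
      · simp
      · intro i' _ hi'
        simp [Pi.mulSingle_eq_of_ne hi']
      · simp
    simp only [MonoidHom.comp_apply, Subgroup.subtype_apply]
    rw [h1, ← AddChar.map_zero_eq_one (ZMod.stdAddChar (N := E.q i)),
      ZMod.injective_stdAddChar.ne_iff]
    exact one_ne_zero

end ExampleData

/-! ### The case analysis for `H` and `K` -/

namespace ExampleData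

variable {E : ExampleData}

/-- The indices of the factors of `H`. -/
def indicesH : Finset (Fin 4 ⊕ Fin 4 ⊕ Fin 4) :=
  {.inl 0, .inl 1, .inr (.inl 0), .inr (.inl 2), .inr (.inr 0)}

/-- The indices of the factors of `K`. -/
def indicesK : Finset (Fin 4 ⊕ Fin 4 ⊕ Fin 4) :=
  {.inl 1, .inl 2, .inl 3, .inr (.inl 1), .inr (.inl 3), .inr (.inr 0), .inr (.inr 2),
    .inr (.inr 3)}

variable (E) in
theorem H_eq_block : E.H = E.block indicesH := by
  apply le_antisymm
  · refine sup_le (sup_le (sup_le (sup_le ?_ ?_) ?_) ?_) ?_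
    · exact factor_le_block (a := .inl 0) (by decide)
    · exact factor_le_block (a := .inl 1) (by decide)
    · exact factor_le_block (a := .inr (.inl 0)) (by decide)
    · exact factor_le_block (a := .inr (.inl 2)) (by decide)
    · exact factor_le_block (a := .inr (.inr 0)) (by decide)
  · refine block_le fun a ha => ?_
    simp only [indicesH, Finset.mem_insert, Finset.mem_singleton] at ha
    have hle : E.Q 0 ⊔ E.Q 1 ⊔ E.R 0 ⊔ E.R 2 ⊔ E.V 0 ≤ E.H := le_rfl
    simp only [sup_le_iff] at hle
    obtain ⟨⟨⟨⟨h1, h2⟩, h3⟩, h4⟩, h5⟩ := hle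
    rcases ha with rfl | rfl | rfl | rfl | rfl
    exacts [h1, h2, h3, h4, h5]

variable (E) in
theorem K_eq_block : E.K = E.block indicesK := by
  apply le_antisymm
  · refine sup_le (sup_le (sup_le (sup_le (sup_le (sup_le (sup_le ?_ ?_) ?_) ?_) ?_) ?_) ?_) ?_
    · exact factor_le_block (a := .inl 1) (by decide)
    · exact factor_le_block (a := .inl 2) (by decide)
    · exact factor_le_block (a := .inl 3) (by decide)
    · exact factor_le_block (a := .inr (.inl 1)) (by decide)
    · exact factor_le_block (a := .inr (.inl 3)) (by decide)
    · exact factor_le_block (a := .inr (.inr 0)) (by decide)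
    · exact factor_le_block (a := .inr (.inr 2)) (by decide)
    · exact factor_le_block (a := .inr (.inr 3)) (by decide)
  · refine block_le fun a ha => ?_
    simp only [indicesK, Finset.mem_insert, Finset.mem_singleton] at ha
    have hle : E.Q 1 ⊔ E.Q 2 ⊔ E.Q 3 ⊔ E.R 1 ⊔ E.R 3 ⊔ E.V 0 ⊔ E.V 2 ⊔ E.V 3 ≤ E.K := le_rfl
    simp only [sup_le_iff] at hle
    obtain ⟨⟨⟨⟨⟨⟨⟨h1, h2⟩, h3⟩, h4⟩, h5⟩, h6⟩, h7⟩, h8⟩ := hle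
    rcases ha with rfl | rfl | rfl | rfl | rfl | rfl | rfl | rfl
    exacts [h1, h2, h3, h4, h5, h6, h7, h8]

variable {n : ℕ}

theorem card_primeFactors_codegree_le_two
    (ρ : Representation ℂ (E.block indicesH) (Fin n → ℂ)) (hρ : ρ.IsIrreducible) :
    (codegree ρ).primeFactors.card ≤ 2 := by
  have hV0 : E.V 0 ≤ kerBlock ρ → ¬ E.factorPrime (.inr (.inr 0)) ∣ codegree ρ := fun h =>
    not_dvd_codegree_of_factor_le_kerBlock hρ (by decide) h
  have hR0 : E.R 0 ≤ kerBlock ρ → ¬ E.factorPrime (.inr (.inl 0)) ∣ codegree ρ := fun h =>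
    not_dvd_codegree_of_factor_le_kerBlock hρ (by decide) h
  have hR2 : E.R 2 ≤ kerBlock ρ → ¬ E.factorPrime (.inr (.inl 2)) ∣ codegree ρ := fun h =>
    not_dvd_codegree_of_factor_le_kerBlock hρ (by decide) h
  have hQ1V0 : ¬ E.V 0 ≤ kerBlock ρ → ¬ E.factorPrime (.inl 1) ∣ codegree ρ := fun h =>
    not_dvd_codegree_of_actsFPF_V hρ (by decide) (by decide) rfl (actsFPF_Q_V (by decide)) h
  have hR0V0 : ¬ E.V 0 ≤ kerBlock ρ → ¬ E.factorPrime (.inr (.inl 0)) ∣ codegree ρ := fun h =>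
    not_dvd_codegree_of_actsFPF_V hρ (by decide) (by decide) rfl (actsFPF_R_V (by decide)) h
  -- `R_2` centralizes `V_0`, the only module in `H`, so no assumption on `V_0` is needed here, in
  -- contrast to `hQ0R0`.
  have hQR2 : ¬ E.R 2 ≤ kerBlock ρ → ∀ i ∈ ({0, 1} : Finset (Fin 4)),
      ¬ E.factorPrime (.inl i) ∣ codegree ρ := fun h i hi =>
    not_dvd_codegree_of_actsFPF_R hρ (by revert i; decide) (by decide) rfl
      (actsFPF_Q_R (by revert i; decide)) h fun k hk hk' => absurd hk' (by revert k; decide)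
  have hQ0R0 : E.V 0 ≤ kerBlock ρ → ¬ E.R 0 ≤ kerBlock ρ →
      ¬ E.factorPrime (.inl 0) ∣ codegree ρ := fun h0 h =>
    not_dvd_codegree_of_actsFPF_R hρ (by decide) (by decide) rfl
      (actsFPF_Q_R (by decide)) h fun k hk _ => by
        obtain rfl : k = 0 := by revert k; decide
        exact h0
  have hQ0R2 := fun h => hQR2 h 0 (by decide)
  have hQ1R2 := fun h => hQR2 h 1 (by decide)
  -- In each case `S` collects three excluded primes out of five.
  have key := fun S hS hN => card_primeFactors_codegree_le (N := 2) hρ S hS hN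
  by_cases h0 : E.V 0 ≤ kerBlock ρ
  · by_cases h2 : E.R 2 ≤ kerBlock ρ
    · by_cases h1 : E.R 0 ≤ kerBlock ρ
      · refine key {.inr (.inl 0), .inr (.inl 2), .inr (.inr 0)} ?_ (by decide)
        simp [hV0 h0, hR2 h2, hR0 h1]
      · refine key {.inl 0, .inr (.inl 2), .inr (.inr 0)} ?_ (by decide)
        simp [hV0 h0, hR2 h2, hQ0R0 h0 h1]
    · refine key {.inl 0, .inl 1, .inr (.inr 0)} ?_ (by decide)
      simp [hV0 h0, hQ0R2 h2, hQ1R2 h2]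
  · by_cases h2 : E.R 2 ≤ kerBlock ρ
    · refine key {.inl 1, .inr (.inl 0), .inr (.inl 2)} ?_ (by decide)
      simp [hQ1V0 h0, hR0V0 h0, hR2 h2]
    · refine key {.inl 0, .inl 1, .inr (.inl 0)} ?_ (by decide)
      simp [hQ0R2 h2, hQ1R2 h2, hR0V0 h0]

theorem card_primeFactors_codegree_le_three
    (ρ : Representation ℂ (E.block indicesK) (Fin n → ℂ)) (hρ : ρ.IsIrreducible) :
    (codegree ρ).primeFactors.card ≤ 3 := by
  have hV : ∀ k, .inr (.inr k) ∈ indicesK → E.V k ≤ kerBlock ρ →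
      ¬ E.factorPrime (.inr (.inr k)) ∣ codegree ρ :=
    fun k hk h => not_dvd_codegree_of_factor_le_kerBlock hρ hk h
  have hR : ∀ j, .inr (.inl j) ∈ indicesK → E.R j ≤ kerBlock ρ →
      ¬ E.factorPrime (.inr (.inl j)) ∣ codegree ρ :=
    fun j hj h => not_dvd_codegree_of_factor_le_kerBlock hρ hj h
  have hQV : ∀ i k, .inl i ∈ indicesK → .inr (.inr k) ∈ indicesK → i ∉ blockIndices k →
      ¬ E.V k ≤ kerBlock ρ → ¬ E.factorPrime (.inl i) ∣ codegree ρ :=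
    fun i k hi hk hik h => not_dvd_codegree_of_actsFPF_V hρ hi hk rfl (actsFPF_Q_V hik) h
  have hRV : ∀ j k, .inr (.inl j) ∈ indicesK → .inr (.inr k) ∈ indicesK → j ∈ blockIndices k →
      ¬ E.V k ≤ kerBlock ρ → ¬ E.factorPrime (.inr (.inl j)) ∣ codegree ρ :=
    fun j k hj hk hjk h => not_dvd_codegree_of_actsFPF_V hρ hj hk rfl (actsFPF_R_V hjk) h
  have hQR : ∀ i j, .inl i ∈ indicesK → .inr (.inl j) ∈ indicesK → j ∈ fpfIndices i →
      ¬ E.R j ≤ kerBlock ρ → (∀ k, .inr (.inr k) ∈ indicesK → j ∈ blockIndices k →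
      E.V k ≤ kerBlock ρ) → ¬ E.factorPrime (.inl i) ∣ codegree ρ :=
    fun i j hi hj hij h => not_dvd_codegree_of_actsFPF_R hρ hi hj rfl (actsFPF_Q_R hij) h
  -- Among the modules `V_0`, `V_2`, `V_3` of `K`, `R_3` acts non-trivially on `V_3` only, and `R_1`
  -- on `V_2` and `V_3` only. These are the modules that must lie in the kernel before `R_3` or
  -- `R_1` can be used.
  have hV3 : E.V 3 ≤ kerBlock ρ → ∀ k, .inr (.inr k) ∈ indicesK →
      3 ∈ blockIndices k → E.V k ≤ kerBlock ρ := fun h k hk hk' => by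
    obtain rfl : k = 3 := by revert k; decide
    exact h
  have hV23 : E.V 2 ≤ kerBlock ρ → E.V 3 ≤ kerBlock ρ → ∀ k, .inr (.inr k) ∈ indicesK →
      1 ∈ blockIndices k → E.V k ≤ kerBlock ρ := fun h h' k hk hk' => by
    obtain rfl | rfl : k = 2 ∨ k = 3 := by revert k; decide
    · exact h
    · exact h'
  -- In each case `S` collects five excluded primes out of eight. If `V_0` is not in the kernel, it
  -- excludes all three `q_i` at once, and `V_2`, `V_3` supply two more primes.
  have key := fun S hS hN => card_primeFactors_codegree_le (N := 3) hρ S hS hN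
  by_cases h0 : E.V 0 ≤ kerBlock ρ
  · have hs0 := hV 0 (by decide) h0
    by_cases h2 : E.V 2 ≤ kerBlock ρ
    · have hs2 := hV 2 (by decide) h2
      by_cases h3 : E.V 3 ≤ kerBlock ρ
      · have hs3 := hV 3 (by decide) h3
        by_cases hR3 : E.R 3 ≤ kerBlock ρ
        · have hr3 := hR 3 (by decide) hR3
          by_cases hR1 : E.R 1 ≤ kerBlock ρ
          · have hr1 := hR 1 (by decide) hR1
            exact key {.inr (.inl 1), .inr (.inl 3), .inr (.inr 0), .inr (.inr 2), .inr (.inr 3)}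
              (by simp [*]) (by decide)
          · have hq1 := hQR 1 1 (by decide) (by decide) (by decide) hR1 (hV23 h2 h3)
            exact key {.inl 1, .inr (.inl 3), .inr (.inr 0), .inr (.inr 2), .inr (.inr 3)}
              (by simp [*]) (by decide)
        · have hq1 := hQR 1 3 (by decide) (by decide) (by decide) hR3 (hV3 h3)
          have hq3 := hQR 3 3 (by decide) (by decide) (by decide) hR3 (hV3 h3)
          exact key {.inl 1, .inl 3, .inr (.inr 0), .inr (.inr 2), .inr (.inr 3)}
            (by simp [*]) (by decide)
      · have hr1 := hRV 1 3 (by decide) (by decide) (by decide) h3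
        have hr3 := hRV 3 3 (by decide) (by decide) (by decide) h3
        have hq2 := hQV 2 3 (by decide) (by decide) (by decide) h3
        exact key {.inl 2, .inr (.inl 1), .inr (.inl 3), .inr (.inr 0), .inr (.inr 2)}
          (by simp [*]) (by decide)
    · have hr1 := hRV 1 2 (by decide) (by decide) (by decide) h2
      have hq3 := hQV 3 2 (by decide) (by decide) (by decide) h2
      by_cases h3 : E.V 3 ≤ kerBlock ρ
      · have hs3 := hV 3 (by decide) h3
        by_cases hR3 : E.R 3 ≤ kerBlock ρ
        · have hr3 := hR 3 (by decide) hR3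
          exact key {.inl 3, .inr (.inl 1), .inr (.inl 3), .inr (.inr 0), .inr (.inr 3)}
            (by simp [*]) (by decide)
        · have hq1 := hQR 1 3 (by decide) (by decide) (by decide) hR3 (hV3 h3)
          exact key {.inl 1, .inl 3, .inr (.inl 1), .inr (.inr 0), .inr (.inr 3)}
            (by simp [*]) (by decide)
      · have hr3 := hRV 3 3 (by decide) (by decide) (by decide) h3
        have hq2 := hQV 2 3 (by decide) (by decide) (by decide) h3
        exact key {.inl 2, .inl 3, .inr (.inl 1), .inr (.inl 3), .inr (.inr 0)}
          (by simp [*]) (by decide)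
  · have hq1 := hQV 1 0 (by decide) (by decide) (by decide) h0
    have hq2 := hQV 2 0 (by decide) (by decide) (by decide) h0
    have hq3 := hQV 3 0 (by decide) (by decide) (by decide) h0
    by_cases h3 : E.V 3 ≤ kerBlock ρ
    · have hs3 := hV 3 (by decide) h3
      by_cases h2 : E.V 2 ≤ kerBlock ρ
      · have hs2 := hV 2 (by decide) h2
        exact key {.inl 1, .inl 2, .inl 3, .inr (.inr 2), .inr (.inr 3)} (by simp [*]) (by decide)
      · have hr1 := hRV 1 2 (by decide) (by decide) (by decide) h2
        exact key {.inl 1, .inl 2, .inl 3, .inr (.inl 1), .inr (.inr 3)} (by simp [*]) (by decide)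
    · have hr1 := hRV 1 3 (by decide) (by decide) (by decide) h3
      have hr3 := hRV 3 3 (by decide) (by decide) (by decide) h3
      exact key {.inl 1, .inl 2, .inl 3, .inr (.inl 1), .inr (.inl 3)} (by simp [*]) (by decide)

variable (E) in
theorem sigmaCod_H : sigmaCod E.H = 2 := by
  rw [H_eq_block]
  exact sigmaCod_block (fun _ => card_primeFactors_codegree_le_two) {0, 1} (by decide) (by decide)

variable (E) in
theorem card_primeSet_H : (primeSet E.H).card = 5 := by
  rw [H_eq_block, card_primeSet_block]
  decide

variable (E) in
theorem sigmaCod_K : sigmaCod E.K = 3 := by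
  rw [K_eq_block]
  exact sigmaCod_block (fun _ => card_primeFactors_codegree_le_three) {1, 2, 3} (by decide)
    (by decide)

variable (E) in
theorem card_primeSet_K : (primeSet E.K).card = 8 := by
  rw [K_eq_block, card_primeSet_block]
  decide

end ExampleData

/-! ### Existence of the example groups -/

theorem exists_injective_prime_modEq_one {N : ℕ} (hN : N ≠ 0) :
    ∃ f : Fin 4 → ℕ, Function.Injective f ∧ ∀ i, (f i).Prime ∧ N ∣ f i - 1 := by
  let e := Set.Infinite.natEmbedding _ (Nat.infinite_setOfPred_prime_modEq_one hN)
  refine ⟨fun i => e i, fun i j h => Fin.ext (e.injective (Subtype.ext h)), fun i => ?_⟩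
  exact ⟨(e i).2.1, (Nat.modEq_iff_dvd' (e i).2.1.one_lt.le).1 (e i).2.2.symm⟩

/-- The group of units is cyclic of order `p - 1`; a suitable power of a generator has order `n`. -/
theorem exists_injective_hom_units {n p : ℕ} [Fact p.Prime] (h : n ∣ p - 1) :
    ∃ f : Multiplicative (ZMod n) →* (ZMod p)ˣ, Function.Injective f := by
  obtain ⟨g, hg⟩ := IsCyclic.exists_ofOrder_eq_natCard (α := (ZMod p)ˣ)
  rw [Nat.card_eq_fintype_card, ZMod.card_units] at hg
  obtain ⟨t, ht⟩ := h
  have hpos : 0 < p - 1 := Nat.sub_pos_of_lt (Fact.out : p.Prime).one_lt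
  have ht0 : t ≠ 0 := by
    rintro rfl
    omega
  have horder : orderOf (g ^ t) = n := by
    rw [orderOf_pow_of_dvd ht0 (hg ▸ ht ▸ Dvd.intro_left _ rfl), hg, ht,
      Nat.mul_div_cancel _ (Nat.pos_of_ne_zero ht0)]
  let F : ZMod n →+ Additive (ZMod p)ˣ := ZMod.lift n ⟨zmultiplesHom _ (Additive.ofMul (g ^ t)), by
    simp only [zmultiplesHom_apply, natCast_zsmul, ← ofMul_pow, ← horder, pow_orderOf_eq_one,
      ofMul_one]⟩
  have hF : Function.Injective F := by
    refine (ZMod.lift_injective _).2 fun m hm => ?_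
    have h1 : (g ^ t) ^ m = 1 := hm
    rw [ZMod.intCast_zmod_eq_zero_iff_dvd, ← horder]
    exact orderOf_dvd_iff_zpow_eq_one.2 h1
  exact ⟨AddMonoidHom.toMultiplicativeLeft F, hF⟩

/-- Raising to the product of the other exponents removes every factor except `u i`. -/
theorem eq_one_of_prod_eq_one_of_coprime {M ι : Type*} [CommMonoid M] [DecidableEq ι]
    {s : Finset ι} {u : ι → M} {n : ι → ℕ} (hn : ∀ i j, i ≠ j → (n i).Coprime (n j))
    (hu : ∀ i, u i ^ n i = 1) (h : ∏ i ∈ s, u i = 1) {i : ι} (hi : i ∈ s) : u i = 1 := by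
  refine eq_one_of_pow_eq_one_of_coprime (Nat.Coprime.prod_right
    (t := s.erase i) (s := n) fun j hj => hn i j (Finset.ne_of_mem_erase hj).symm) (hu i) ?_
  have h1 : (∏ j ∈ s, u j) ^ (∏ j ∈ s.erase i, n j) = 1 := by rw [h, one_pow]
  rwa [← Finset.prod_pow, Finset.prod_eq_single_of_mem i hi] at h1
  intro j hj hji
  obtain ⟨t, ht⟩ := Finset.dvd_prod_of_mem n (Finset.mem_erase.2 ⟨hji, hj⟩)
  rw [ht, pow_mul, hu, one_pow]

/-- The product of homomorphisms from the factors of a direct product to a commutative monoid. -/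
def piProdHom {ι N : Type*} [Fintype ι] {M : ι → Type*} [∀ i, Monoid (M i)] [CommMonoid N]
    (f : ∀ i, M i →* N) : (∀ i, M i) →* N :=
  ∏ i, (f i).comp (Pi.evalMonoidHom M i)

section piProdHom

variable {ι N : Type*} [Fintype ι] {M : ι → Type*} [∀ i, Monoid (M i)] [CommMonoid N]
  (f : ∀ i, M i →* N)

theorem piProdHom_apply (x : ∀ i, M i) : piProdHom f x = ∏ i, f i (x i) := by
  simp [piProdHom]

theorem piProdHom_mulSingle [DecidableEq ι] (i : ι) (x : M i) :
    piProdHom f (Pi.mulSingle i x) = f i x := by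
  rw [piProdHom_apply, Finset.prod_eq_single i, Pi.mulSingle_eq_same]
  · intro j _ hj
    rw [Pi.mulSingle_eq_of_ne hj, map_one]
  · exact fun h => absurd (Finset.mem_univ i) h

end piProdHom

/-! ### Monomial representations -/

section Monomial

variable {A X I F : Type*} [CommGroup A] [CommGroup X] [Field F] {φ : X →* MulAut A}

/-- The monomial representation of `A ⋊ X` on the functions on a set `I` with an action of `X`,
for linear characters `Λ i` of `A` that are permuted by `X` as prescribed by this action. -/
def monomialRep (act : X →* Equiv.Perm I) (Λ : I → A →* F)
    (hΛ : ∀ x i a, Λ (act x i) a = Λ i (φ x a)) (μ : X →* F) :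
    Representation F (A ⋊[φ] X) (I → F) where
  toFun l :=
    { toFun := fun f i => μ l.right * Λ i l.left * f (act l.right i)
      map_add' := fun f g => by
        funext i
        simp [mul_add]
      map_smul' := fun c f => by
        funext i
        simp [mul_left_comm] }
  map_one' := by
    ext f i
    simp
  map_mul' l m := by
    ext1 f
    funext i
    have h : act l.right * act m.right = act m.right * act l.right := by
      rw [← map_mul, mul_comm, map_mul]
    simp only [SemidirectProduct.mul_left, SemidirectProduct.mul_right, map_mul, h,
      LinearMap.coe_mk, AddHom.coe_mk, Module.End.mul_apply, Equiv.Perm.coe_mul,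
      Function.comp_apply, hΛ]
    ring

variable (act : X →* Equiv.Perm I) (Λ : I → A →* F)
    (hΛ : ∀ x i a, Λ (act x i) a = Λ i (φ x a)) (μ : X →* F)

theorem monomialRep_apply (l : A ⋊[φ] X) (f : I → F) (i : I) :
    monomialRep act Λ hΛ μ l f i = μ l.right * Λ i l.left * f (act l.right i) := rfl

/-- Distinct characters `Λ i` force a non-zero function of minimal support in a submodule to be
supported at one point; transitivity then yields all point masses. The subgroup `K` only has to
separate the characters and be transitive. -/
theorem isIrreducible_monomialRep [Finite I] [Nonempty I] (K : Subgroup (A ⋊[φ] X))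
    (hsep : ∀ i j, i ≠ j → ∃ a, SemidirectProduct.inl a ∈ K ∧ Λ i a ≠ Λ j a)
    (htrans : ∀ i j, ∃ x, SemidirectProduct.inr x ∈ K ∧ act x i = j) :
    Representation.IsIrreducible ((monomialRep act Λ hΛ μ).comp K.subtype) := by
  classical
  have := Fintype.ofFinite I
  rw [Representation.isIrreducible_iff_forall_submodule]
  refine ⟨inferInstance, fun U hU => or_iff_not_imp_left.2 fun hne => ?_⟩
  have hUK : ∀ l ∈ K, ∀ f ∈ U, monomialRep act Λ hΛ μ l f ∈ U := fun l hl => hU ⟨l, hl⟩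
  obtain ⟨f₀, hf₀, hf₀ne⟩ := (Submodule.ne_bot_iff _).1 hne
  -- a function in `U` with support of minimal size
  obtain ⟨f, ⟨hfU, hfne⟩, hmin⟩ := WellFounded.has_min
    (measure fun f : I → F => (Finset.univ.filter fun i => f i ≠ 0).card).wf
    {f | f ∈ U ∧ f ≠ 0} ⟨f₀, hf₀, hf₀ne⟩
  obtain ⟨i, hi⟩ := Function.ne_iff.1 hfne
  have hsupp : ∀ j, j ≠ i → f j = 0 := by
    by_contra! hcon
    obtain ⟨j, hji, hj⟩ := hcon
    obtain ⟨a, haK, ha⟩ := hsep i j hji.symm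
    -- This combination vanishes at `j` but not at `i`, and its support is no larger than that of
    -- `f`, against minimality.
    let g : I → F := monomialRep act Λ hΛ μ (SemidirectProduct.inl a) f - Λ j a • f
    have hg : ∀ m, g m = (Λ m a - Λ j a) * f m := fun m => by
      simp [g, monomialRep_apply, sub_mul]
    refine hmin g ⟨U.sub_mem (hUK _ haK _ hfU) (U.smul_mem _ hfU), fun h => ?_⟩
      (Finset.card_lt_card ⟨fun m hm => ?_, fun h => ?_⟩)
    · have h1 := congrFun h i
      rw [hg] at h1
      exact (mul_ne_zero (sub_ne_zero.2 ha) hi) h1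
    · simp only [Finset.mem_filter, Finset.mem_univ, true_and, hg] at hm ⊢
      exact right_ne_zero_of_mul hm
    · have h1 := h (Finset.mem_filter.2 ⟨Finset.mem_univ j, hj⟩)
      simp [hg] at h1
  have hsingle : ∀ j, Pi.single j 1 ∈ U := by
    intro j
    obtain ⟨x, hx, hxj⟩ := htrans j i
    have h1 : (μ x * f i)⁻¹ • monomialRep act Λ hΛ μ (SemidirectProduct.inr x) f =
        Pi.single j 1 := by
      have hμ : μ x ≠ 0 := by
        intro h0
        have := map_mul μ x x⁻¹
        simp [h0] at this
      funext m
      rcases eq_or_ne m j with rfl | hm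
      · simp only [Pi.smul_apply, monomialRep_apply, SemidirectProduct.left_inr,
          SemidirectProduct.right_inr, map_one, mul_one, smul_eq_mul, Pi.single_eq_same, hxj]
        exact inv_mul_cancel₀ (mul_ne_zero hμ hi)
      · have h2 : act x m ≠ i := by
          rw [← hxj]
          exact (act x).injective.ne hm
        simp [monomialRep_apply, hm, hsupp _ h2]
    rw [← h1]
    exact U.smul_mem _ (hUK _ hx _ hfU)
  rw [eq_top_iff]
  intro g _
  rw [pi_eq_sum_univ' g]
  exact U.sum_mem fun j _ => U.smul_mem _ (by
    convert hsingle j using 1)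

end Monomial

/-! ### Construction of `L` and of the modules `V_k` -/

namespace TopData

/-- `Q_i` acts on `R_j = ℤ/r_j` by multiplication through a character `θ i j` that is injective or
trivial. The formula for `φ` is part of the conclusion because the modules are built from it. -/
theorem exists_topData (q : Fin 4 → ℕ) (hq : ∀ i, (q i).Prime) (hinj : Function.Injective q) :
    ∃ (D : TopData) (θ : ∀ i j, Multiplicative (ZMod (D.q i)) →* (ZMod (D.r j))ˣ), D.q = q ∧
      (∀ i, ∀ j ∈ fpfIndices i, Function.Injective (θ i j)) ∧
      (∀ i, ∀ j ∉ fpfIndices i, θ i j = 1) ∧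
      ∀ x a j, D.φ x a j =
        Multiplicative.ofAdd (((∏ i, θ i j (x i) : (ZMod (D.r j))ˣ) : ZMod (D.r j)) *
          Multiplicative.toAdd (a j)) := by
  -- Taking every `r_j` congruent to 1 modulo the product of all `q_i` meets all divisibility
  -- conditions at once and makes `r_j` different from the `q_i`.
  obtain ⟨r, hr, hrq⟩ := exists_injective_prime_modEq_one
    (Finset.prod_ne_zero_iff.2 fun i (_ : i ∈ Finset.univ) => (hq i).ne_zero)
  have hdvd : ∀ i j, q i ∣ r j - 1 := fun i j =>
    (Finset.dvd_prod_of_mem q (Finset.mem_univ i)).trans (hrq j).2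
  have : ∀ j, Fact (r j).Prime := fun j => ⟨(hrq j).1⟩
  choose ζ hζ using fun i j => exists_injective_hom_units (hdvd i j)
  let θ : ∀ i j, Multiplicative (ZMod (q i)) →* (ZMod (r j))ˣ := fun i j =>
    if j ∈ fpfIndices i then ζ i j else 1
  have hθ : ∀ i, ∀ j ∈ fpfIndices i, Function.Injective (θ i j) := fun i j h => by
    simp only [θ, if_pos h]
    exact hζ i j
  have hθ' : ∀ i, ∀ j ∉ fpfIndices i, θ i j = 1 := fun i j h => if_neg h
  let u : ∀ j, (∀ i, Multiplicative (ZMod (q i))) →* (ZMod (r j))ˣ := fun j =>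
    piProdHom fun i => θ i j
  have hu : ∀ i j x, u j (Pi.mulSingle i x) = θ i j x := fun i j x =>
    piProdHom_mulSingle (fun i => θ i j) i x
  let φ : (∀ i, Multiplicative (ZMod (q i))) →* MulAut (∀ j, Multiplicative (ZMod (r j))) :=
    { toFun := fun x =>
        { toFun := fun a j => Multiplicative.ofAdd ((u j x : ZMod (r j)) *
            Multiplicative.toAdd (a j))
          invFun := fun a j => Multiplicative.ofAdd (((u j x)⁻¹ : (ZMod (r j))ˣ) *
            Multiplicative.toAdd (a j))
          left_inv := fun a => funext fun j =>
            congrArg Multiplicative.ofAdd (Units.inv_mul_cancel_left (u j x) _)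
          right_inv := fun a => funext fun j =>
            congrArg Multiplicative.ofAdd (Units.mul_inv_cancel_left (u j x) _)
          map_mul' := fun a b => funext fun j => congrArg Multiplicative.ofAdd (mul_add _ _ _) }
      map_one' := MulEquiv.ext fun a => funext fun j => by
        change Multiplicative.ofAdd ((u j 1 : ZMod (r j)) * Multiplicative.toAdd (a j)) = a j
        rw [map_one, Units.val_one, one_mul, ofAdd_toAdd]
      map_mul' := fun x y => MulEquiv.ext fun a => funext fun j => by
        change Multiplicative.ofAdd ((u j (x * y) : ZMod (r j)) * Multiplicative.toAdd (a j)) =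
          Multiplicative.ofAdd ((u j x : ZMod (r j)) *
            ((u j y : ZMod (r j)) * Multiplicative.toAdd (a j)))
        rw [map_mul (u j), Units.val_mul, mul_assoc] }
  have hφ : ∀ x a j, φ x a j = Multiplicative.ofAdd ((u j x : ZMod (r j)) *
    Multiplicative.toAdd (a j)) := fun _ _ _ => rfl
  have hprod : ∏ i, q i = q 0 * q 1 * q 2 * q 3 := Fin.prod_univ_four q
  refine ⟨{ q := q, r := r, q_prime := hq, r_prime := fun j => (hrq j).1, distinct := ?_,
            dvd_zero := hdvd 0 0, dvd_one := hdvd 1 1, dvd_two := ?_, dvd_three := ?_, φ := φ,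
            acts_fpf := ?_, acts_trivially := ?_ }, θ, rfl, hθ, hθ',
            fun x a j => by rw [hφ, piProdHom_apply]⟩
  · have hne : ∀ i j, q i ≠ r j := fun i j h => by
      have h1 := Nat.le_of_dvd (Nat.sub_pos_of_lt (hrq j).1.one_lt) (hdvd i j)
      have := (hq i).pos
      omega
    rintro (i | i) (j | j) h
    · exact congrArg _ (hinj h)
    · exact (hne _ _ h).elim
    · exact (hne _ _ h.symm).elim
    · exact congrArg _ (hr h)
  · exact (Dvd.intro (q 3) hprod.symm).trans (hrq 2).2
  · exact (Dvd.intro (q 0 * q 2) (by rw [hprod]; ring)).trans (hrq 3).2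
  · intro i j hj x hx y hy h
    have h1 := congrFun h j
    rw [hφ, hu, Pi.mulSingle_eq_same] at h1
    have h2 : (θ i j x : ZMod (r j)) * Multiplicative.toAdd y = Multiplicative.toAdd y := h1
    have h3 := mul_right_cancel₀
      (show Multiplicative.toAdd y ≠ 0 from hy) (h2.trans (one_mul _).symm)
    exact hx ((injective_iff_map_eq_one _).1 (hθ i j hj) x (Units.ext h3))
  · intro i j hj x y
    funext j'
    rw [hφ, hu]
    rcases eq_or_ne j' j with rfl | hj'
    · simp [hθ' i j' hj]
    · simp [Pi.mulSingle_eq_of_ne hj']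

variable (D : TopData)

/-- The elements of `L` whose components with index outside `T` are trivial. -/
def support (T : Finset (Fin 4)) : Subgroup D.L where
  carrier := {g | (∀ i ∉ T, g.right i = 1) ∧ ∀ j ∉ T, g.left j = 1}
  one_mem' := ⟨fun _ _ => rfl, fun _ _ => rfl⟩
  mul_mem' := by
    rintro a b ⟨ha, ha'⟩ ⟨hb, hb'⟩
    exact ⟨fun i hi => by simp [ha i hi, hb i hi],
      fun j hj => by simp [ha' j hj, D.φ_apply_eq_one _ _ j (hb' j hj)]⟩
  inv_mem' := by
    rintro a ⟨ha, ha'⟩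
    exact ⟨fun i hi => by simp [ha i hi],
      fun j hj => by
        rw [SemidirectProduct.inv_left]
        exact D.φ_apply_eq_one _ _ j (by simp [ha' j hj])⟩

variable {D} {T : Finset (Fin 4)}

theorem ιR_mem_support {j : Fin 4} (hj : j ∈ T) (y) : D.ιR j y ∈ D.support T :=
  ⟨fun _ _ => rfl, fun _ hj' => Pi.mulSingle_eq_of_ne (ne_of_mem_of_not_mem hj hj').symm _⟩

theorem subQR_le_support : D.subQR T ≤ D.support T := by
  refine iSup₂_le fun i hi => sup_le ?_ ?_
  · rintro _ ⟨x, rfl⟩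
    exact ⟨fun _ hi' => Pi.mulSingle_eq_of_ne (ne_of_mem_of_not_mem hi hi').symm _, fun _ _ => rfl⟩
  · rintro _ ⟨y, rfl⟩
    exact ιR_mem_support hi y

theorem subR_le_support : D.subR T ≤ D.support T ⊓ SemidirectProduct.rightHom.ker := by
  refine iSup₂_le fun i hi => ?_
  rintro _ ⟨y, rfl⟩
  exact ⟨ιR_mem_support hi y, rfl⟩

theorem ιR_mem_subQR {j : Fin 4} (hj : j ∈ T) (y) : D.ιR j y ∈ D.subQR T :=
  Subgroup.mem_iSup_of_mem j (Subgroup.mem_iSup_of_mem hj (Subgroup.mem_sup_right ⟨y, rfl⟩))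

theorem inr_mem_subQR (x : ∀ i, Multiplicative (ZMod (D.q i))) (hx : ∀ i ∉ T, x i = 1) :
    (SemidirectProduct.inr x : D.L) ∈ D.subQR T := by
  refine map_mem_of_mulSingle_mem _ _ _ fun i => ?_
  by_cases hi : i ∈ T
  · exact Subgroup.mem_iSup_of_mem i (Subgroup.mem_iSup_of_mem hi
      (Subgroup.mem_sup_left ⟨x i, rfl⟩))
  · rw [hx i hi, Pi.mulSingle_one, map_one]
    exact one_mem _

/-- The module consists of the functions on `Z = ∏ Q_i`, `i ∈ T`. The `R_j`, `j ∈ T`, act diagonally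
by the twists under `Z` of one faithful linear character of their product, and `Z` permutes the
coordinates regularly up to scalars. By `hT` the other `Q_i` leave these characters fixed, which is
why they can act as scalars. -/
theorem exists_module (θ : ∀ i j, Multiplicative (ZMod (D.q i)) →* (ZMod (D.r j))ˣ)
    (hθ : ∀ i, ∀ j ∈ fpfIndices i, Function.Injective (θ i j))
    (hθ' : ∀ i, ∀ j ∉ fpfIndices i, θ i j = 1)
    (hφ : ∀ x a j, D.φ x a j =
      Multiplicative.ofAdd (((∏ i, θ i j (x i) : (ZMod (D.r j))ˣ) : ZMod (D.r j)) *
        Multiplicative.toAdd (a j)))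
    (hT : ∀ i ∉ T, ∀ j ∈ T, j ∉ fpfIndices i) (s : ℕ) [Fact s.Prime]
    (hs : (∏ i, D.q i) * (∏ i, D.r i) ∣ s - 1) :
    ∃ (d : ℕ) (ρ : Representation (ZMod s) D.L (Fin d → ZMod s)),
      (∀ g ∈ D.subQR T, ρ g = 1 → g = 1) ∧
      Representation.IsIrreducible (ρ.comp (D.subQR T).subtype) ∧
      (∀ g ∈ D.subR T, g ≠ 1 → ∀ v, ρ g v = v → v = 0) ∧
      (∀ i ∉ T, ∀ x, ∃ c : ZMod s, ∀ v, ρ (D.ιQ i x) v = c • v) ∧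
      (∀ i ∉ T, ∀ x, x ≠ 1 → ∀ v, ρ (D.ιQ i x) v = v → v = 0) ∧
      ∀ i ∉ T, ∀ y, ρ (D.ιR i y) = 1 := by
  classical
  choose η hη using fun i => exists_injective_hom_units (p := s)
    (((Finset.dvd_prod_of_mem D.q (Finset.mem_univ i)).trans (Dvd.intro _ rfl)).trans hs)
  choose lam hlam using fun j => exists_injective_hom_units (p := s)
    (((Finset.dvd_prod_of_mem D.r (Finset.mem_univ j)).trans (Dvd.intro_left _ rfl)).trans hs)
  let Z := ∀ i : T, Multiplicative (ZMod (D.q i))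
  let e : Z ≃ Fin (Nat.card Z) := Finite.equivFin Z
  let res : (∀ i, Multiplicative (ZMod (D.q i))) →* Z :=
    { toFun := fun x i => x i, map_one' := rfl, map_mul' := fun _ _ => rfl }
  let act : (∀ i, Multiplicative (ZMod (D.q i))) →* Equiv.Perm (Fin (Nat.card Z)) :=
    { toFun := fun x => e.permCongr (Equiv.mulLeft (res x))
      map_one' := by
        ext i
        simp
      map_mul' := fun x y => by
        ext i
        simp }
  have hact : ∀ x i, e.symm (act x i) = res x * e.symm i := fun x i => by simp [act]
  let U : ∀ j, Z →* (ZMod (D.r j))ˣ := fun j => piProdHom fun i : T => θ i j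
  have hUres : ∀ x, ∀ j ∈ T, U j (res x) = ∏ i, θ i j (x i) := fun x j hj => by
    refine (piProdHom_apply _ _).trans <| (Finset.prod_coe_sort T fun i => θ i j (x i)).trans
      (Finset.prod_subset (Finset.subset_univ T) fun i _ hi => ?_)
    rw [hθ' i j (hT i hi j hj), MonoidHom.one_apply]
  -- Each `Q_i` acts faithfully on `R_i`, and the orders `q_i` are coprime, so `Z` acts faithfully
  -- on the product of the `R_j`. Hence the twisted characters are distinct.
  have hUinj : ∀ z, (∀ j ∈ T, U j z = 1) → z = 1 := by
    intro z hz
    funext i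
    have hcop : ∀ i j : T, i ≠ j → (D.q i).Coprime (D.q j) := fun i j hij =>
      (Nat.coprime_primes (D.q_prime _) (D.q_prime _)).2
        (D.q_injective.ne fun h => hij (Subtype.ext h))
    have h1 := eq_one_of_prod_eq_one_of_coprime (s := Finset.univ) (i := i)
      (u := fun i' : T => θ i' i (z i')) hcop
      (fun i' => by rw [← map_pow, Multiplicative.pow_zmod_eq_one, map_one])
      ((piProdHom_apply _ _).symm.trans (hz i i.2))
      (Finset.mem_univ i)
    have hii : ∀ i, i ∈ fpfIndices i := by decide
    exact (injective_iff_map_eq_one _).1 (hθ i i (hii i)) _ h1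
  let Λ₀ : Fin (Nat.card Z) → (∀ j, Multiplicative (ZMod (D.r j))) →* (ZMod s)ˣ := fun i =>
    { toFun := fun a => ∏ j ∈ T, lam j (Multiplicative.ofAdd
        ((U j (e.symm i) : ZMod (D.r j)) * Multiplicative.toAdd (a j)))
      map_one' := by simp
      map_mul' := fun a b => by simp [mul_add, ofAdd_add, Finset.prod_mul_distrib] }
  have hΛ₀ : ∀ i a, Λ₀ i a = ∏ j ∈ T, lam j (Multiplicative.ofAdd
        ((U j (e.symm i) : ZMod (D.r j)) * Multiplicative.toAdd (a j))) := fun _ _ => rfl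
  have hΛ₀single : ∀ i j y, j ∈ T → Λ₀ i (Pi.mulSingle j y) =
      lam j (Multiplicative.ofAdd ((U j (e.symm i) : ZMod (D.r j)) * Multiplicative.toAdd y)) := by
    intro i j y hj
    rw [hΛ₀, Finset.prod_eq_single_of_mem j hj, Pi.mulSingle_eq_same]
    intro j' _ hj'
    simp [Pi.mulSingle_eq_of_ne hj']
  -- Each twisted character is faithful on the product of the `R_j`, `j ∈ T`. This gives fixed point
  -- freeness on every coordinate.
  have hΛ₀one : ∀ i a, (∀ j ∉ T, a j = 1) → Λ₀ i a = 1 → a = 1 := by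
    intro i a ha h
    funext j
    by_cases hj : j ∈ T
    · have h1 := eq_one_of_prod_eq_one_of_coprime (fun _ _ => D.coprime_r)
        (fun j => by rw [← map_pow, Multiplicative.pow_zmod_eq_one, map_one]) h hj
      have h2 : (U j (e.symm i) : ZMod (D.r j)) * Multiplicative.toAdd (a j) = 0 :=
        (injective_iff_map_eq_one _).1 (hlam j) _ h1
      exact (mul_eq_zero.1 h2).resolve_left (Units.ne_zero _)
    · exact ha j hj
  let Λ : Fin (Nat.card Z) → (∀ j, Multiplicative (ZMod (D.r j))) →* ZMod s := fun i =>
    (Units.coeHom _).comp (Λ₀ i)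
  have hΛ : ∀ x i a, Λ (act x i) a = Λ i (D.φ x a) := fun x i a => by
    refine congrArg Units.val (Finset.prod_congr rfl fun j hj => ?_)
    rw [hact, map_mul (U j), hUres x j hj, hφ, Units.val_mul]
    rw [toAdd_ofAdd, mul_assoc, mul_left_comm]
  -- The factor `μ₀` makes the `Q_i`, `i ∉ T`, act by faithful scalars. It is also present for `i ∈
  -- T`, harmlessly: faithfulness there is read off from the permutation of the coordinates.
  let μ₀ : (∀ i, Multiplicative (ZMod (D.q i))) →* (ZMod s)ˣ := piProdHom η
  let ρ := monomialRep (φ := D.φ) act Λ hΛ ((Units.coeHom _).comp μ₀)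
  have hρ : ∀ l f i, ρ l f i = (μ₀ l.right : ZMod s) * (Λ₀ i l.left : ZMod s) *
    f (act l.right i) := fun _ _ _ => rfl
  have hscalar : ∀ i ∉ T, ∀ x v, ρ (D.ιQ i x) v = (η i x : ZMod s) • v := by
    intro i hi x v
    have h1 : res (Pi.mulSingle i x) = 1 := by
      funext i'
      exact Pi.mulSingle_eq_of_ne (ne_of_mem_of_not_mem i'.2 hi) _
    funext m
    have h2 : act (Pi.mulSingle i x) m = m := e.symm.injective (by rw [hact, h1, one_mul])
    rw [hρ]
    change (μ₀ (Pi.mulSingle i x) : ZMod s) * (Λ₀ m 1 : ZMod s) * v (act (Pi.mulSingle i x) m) = _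
    rw [h2, piProdHom_mulSingle, map_one, Units.val_one, mul_one, Pi.smul_apply, smul_eq_mul]
  have hne : Nonempty (Fin (Nat.card Z)) := ⟨e 1⟩
  refine ⟨Nat.card Z, ρ, ?_, ?_, ?_, fun i hi x => ⟨_, hscalar i hi x⟩, ?_, ?_⟩
  · intro g hg h
    obtain ⟨hgQ, hgR⟩ := subQR_le_support hg
    have hright : g.right = 1 := by
      -- Otherwise the point mass at `act g.right (e 1)`, which vanishes at `e 1`, is mapped by `ρ
      -- g` to a function that does not vanish there.
      have h1 : act g.right (e 1) = e 1 := by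
        by_contra h1
        have h2 := congrFun (congrArg (fun f : Module.End (ZMod s) _ =>
          f (Pi.single (act g.right (e 1)) 1)) h) (e 1)
        simp only [hρ, Module.End.one_apply, Pi.single_eq_same, mul_one] at h2
        rw [Pi.single_eq_of_ne (Ne.symm h1), ← Units.val_mul] at h2
        exact Units.ne_zero _ h2
      have h2 : res g.right = 1 := by
        have h3 := hact g.right (e 1)
        rw [h1, Equiv.symm_apply_apply, mul_one] at h3
        exact h3.symm
      funext i
      by_cases hi : i ∈ T
      · exact congrFun h2 ⟨i, hi⟩
      · exact hgQ i hi
    refine SemidirectProduct.ext ?_ hright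
    refine hΛ₀one (e 1) _ hgR (Units.ext ?_)
    have h1 := congrFun (congrArg (fun f : Module.End (ZMod s) _ => f 1) h) (e 1)
    simpa [hρ, hright] using h1
  · refine isIrreducible_monomialRep _ _ _ _ _ (fun i j hij => ?_) fun i j => ?_
    · by_contra! hcon
      refine hij (e.symm.injective (eq_of_div_eq_one (hUinj _ fun m hm => ?_)))
      have h1 : Λ₀ i (Pi.mulSingle m (Multiplicative.ofAdd 1)) =
          Λ₀ j (Pi.mulSingle m (Multiplicative.ofAdd 1)) :=
        Units.ext (hcon _ (ιR_mem_subQR hm (Multiplicative.ofAdd 1)))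
      rw [hΛ₀single _ _ _ hm, hΛ₀single _ _ _ hm] at h1
      have h2 : (U m (e.symm i) : ZMod (D.r m)) * 1 = (U m (e.symm j) : ZMod (D.r m)) * 1 :=
        hlam m h1
      rw [mul_one, mul_one] at h2
      rw [map_div, Units.ext h2, div_self']
    · let x : ∀ i, Multiplicative (ZMod (D.q i)) := fun m =>
        if h : m ∈ T then (e.symm j / e.symm i) ⟨m, h⟩ else 1
      refine ⟨x, inr_mem_subQR x fun m hm => dif_neg hm, e.symm.injective ?_⟩
      have h1 : res x = e.symm j / e.symm i := by
        funext m
        exact dif_pos m.2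
      rw [hact, h1, div_mul_cancel]
  · intro g hg hg1 v hv
    obtain ⟨⟨-, hgR⟩, hright⟩ := subR_le_support hg
    have hright : g.right = 1 := hright
    funext i
    have h1 := congrFun hv i
    rw [hρ, hright, map_one, map_one, Units.val_one, one_mul, Equiv.Perm.one_apply] at h1
    by_contra h0
    have h2 := mul_right_cancel₀ h0 (h1.trans (one_mul _).symm)
    exact hg1 (SemidirectProduct.ext (hΛ₀one i _ hgR (Units.ext h2)) hright)
  · intro i hi x hx v hv
    rw [hscalar i hi] at hv
    by_contra h0
    have h1 : ((η i x : ZMod s) - 1) • v = 0 := by rw [sub_smul, hv, one_smul, sub_self]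
    have h2 := sub_eq_zero.1 ((smul_eq_zero.1 h1).resolve_right h0)
    exact hx ((injective_iff_map_eq_one _).1 (hη i) x (Units.ext h2))
  · intro i hi y
    refine LinearMap.ext fun v => funext fun m => ?_
    have h1 : Λ₀ m (Pi.mulSingle i y) = 1 := Finset.prod_eq_one fun j hj => by
      rw [Pi.mulSingle_eq_of_ne (ne_of_mem_of_not_mem hj hi)]
      simp
    rw [hρ]
    change (μ₀ 1 : ZMod s) * (Λ₀ m (Pi.mulSingle i y) : ZMod s) * v (act 1 m) = _
    rw [h1]
    simp

end TopData

theorem ExampleData.exists_of_primes (q : Fin 4 → ℕ) (hq : ∀ i, (q i).Prime)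
    (hinj : Function.Injective q) : ∃ E : ExampleData, E.q = q := by
  obtain ⟨D, θ, hDq, hθ, hθ', hφ⟩ := TopData.exists_topData q hq hinj
  obtain ⟨s, hsinj, hs⟩ := exists_injective_prime_modEq_one
    (mul_ne_zero (Finset.prod_ne_zero_iff.2 fun i (_ : i ∈ Finset.univ) => (D.q_prime i).ne_zero)
      (Finset.prod_ne_zero_iff.2 fun i (_ : i ∈ Finset.univ) => (D.r_prime i).ne_zero))
  have hsp : ∀ k, Fact (s k).Prime := fun k => ⟨(hs k).1⟩
  -- A property of the index tables: a `Q_i` outside the block of `V_k` centralizes every `R_j` in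
  -- it.
  have hT : ∀ k, ∀ i ∉ blockIndices k, ∀ j ∈ blockIndices k, j ∉ fpfIndices i := by decide
  choose d ρ h1 h2 h3 h4 h5 h6 using fun k =>
    TopData.exists_module θ hθ hθ' hφ (hT k) (s k) (hs k).2
  exact ⟨{ D with
    s := s, s_prime := hsp, s_injective := hsinj, dvd_s := fun k => (hs k).2, d := d, ρ := ρ
    faithful := h1, irreducible := h2, R_fpf := h3, Q_scalar := h4, Q_fpf := h5,
    R_trivial := h6 }, hDq⟩

end

theorem proposition2p4 :
    -- the values for the subgroups `H` and `K` of every example group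
    (∀ E : ExampleData,
      sigmaCod E.H = 2 ∧ (primeSet E.H).card = 5 ∧
      sigmaCod E.K = 3 ∧ (primeSet E.K).card = 8) ∧
    -- example groups exist, the primes `q_i` being arbitrary
    (∀ q : Fin 4 → ℕ, (∀ i, (q i).Prime) → Function.Injective q →
      ∃ E : ExampleData, E.q = q) ∧
    -- so the bounds `5` and `8` are attained
    (∃ (Γ : Type) (_ : Group Γ), Finite Γ ∧ sigmaCod Γ = 2 ∧ (primeSet Γ).card = 5) ∧
    (∃ (Γ : Type) (_ : Group Γ), Finite Γ ∧ sigmaCod Γ = 3 ∧ (primeSet Γ).card = 8) := by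
  obtain ⟨E, -⟩ := ExampleData.exists_of_primes ![2, 3, 5, 7] (by decide) (by decide)
  exact ⟨fun E => ⟨E.sigmaCod_H, E.card_primeSet_H, E.sigmaCod_K, E.card_primeSet_K⟩,
    ExampleData.exists_of_primes,
    ⟨E.H, inferInstance, inferInstance, E.sigmaCod_H, E.card_primeSet_H⟩,
    ⟨E.K, inferInstance, inferInstance, E.sigmaCod_K, E.card_primeSet_K⟩⟩
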